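/- Write $x=(x_1,x_2,x_3)\in\mathbb R^3$, $\mathbb R^3_+=\{x_3>0\}$, $B_0^+(R)=\{x:|x|<R,\ x_3>0\}$, $Q_0^+(R)=B_0^+(R)\times(-R^2,0)$, and $$\|g\|_{L_{s,l}(Q_0^+(R))}=\Big(\int_{-R^2}^0\Big(\int_{B_0^+(R)}|g(x,t)|^s\,dx\Big)^{l/s}dt\Big)^{1/l},\qquad L_2=L_{2,2}.$$ There is an absolute constant $c>0$ such that the following holds for every $R>0$. Let $f\in L_{3/2,1}(Q_0^+(R))$ be $\mathbb R^3$-valued, and let $h:Q_0^+(R)\to\mathbb R^3$ be the solution of $$\partial_t h-\Delta h=f\ \text{ in } Q_0^+(R),\qquad h_3=0,\ \ \partial_3h_1=\partial_3h_2=0\ \text{ on } x_3=0,\qquad h|_{t=-R^2}=0,$$ obtained by continuing $f$ by zero, that is, let $h$ be the restriction to $Q_0^+(R)$ of a solution $u$ of $$\partial_t u-\Delta u=\mathbf 1_{Q_0^+(R)}f\ \text{ in } \mathbb R^3_+\times(-R^2,0),\qquad u_3=0,\ \ \partial_3u_1=\partial_3u_2=0\ \text{ on } x_3=0,\qquad u|_{t=-R^2}=0.$$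 Then $h\in L_2(Q_0^+(R))$ and $$\|h\|_{L_2(Q_0^+(R))}\le c\,R^{1/2}\,\|f\|_{L_{3/2,1}(Q_0^+(R))}.$$ Here $u$ is a solution in the following weak sense: $(1+|x|)^{-N}u\in L_1(\mathbb R^3_+\times(-R^2,0))$ for some $N\in\mathbb N$, and $$\int_{-R^2}^0\int_{\mathbb R^3_+}u\cdot(-\partial_t\eta-\Delta\eta)\,dx\,dt=\int_{Q_0^+(R)}f\cdot\eta\,dx\,dt$$ for all $\eta\in C_c^\infty(\mathbb R^3\times(-\infty,0);\mathbb R^3)$ with $\eta_3=0$ and $\partial_3\eta_1=\partial_3\eta_2=0$ on $x_3=0$. -/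

import Mathlib

open MeasureTheory Set
open scoped ENNReal ContDiff

noncomputable section

/-- Three-dimensional Euclidean space; the coordinates `x₁, x₂, x₃` are `x 0, x 1, x 2`. -/
abbrev E3 : Type := EuclideanSpace ℝ (Fin 3)

/-- The open half-space `{x : x₃ > 0}`. -/
def halfSpace : Set E3 := {x | 0 < x 2}

/-- The open half-ball `B₀⁺(R) = {x : |x| < R, x₃ > 0}`. -/
def halfBall (R : ℝ) : Set E3 := {x | ‖x‖ < R ∧ 0 < x 2}

/-- The time interval `(-R², 0)`. -/
def timeInterval (R : ℝ) : Set ℝ := Ioo (-R ^ 2) 0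

/-- The half-cylinder `Q₀⁺(R) = B₀⁺(R) × (-R², 0)`. -/
def halfCylinder (R : ℝ) : Set (E3 × ℝ) := halfBall R ×ˢ timeInterval R

/-- The norm of the anisotropic Lebesgue space `L_{s,l}(Ω × I)`:
`(∫_I (∫_Ω |f(x,t)|^s dx)^{l/s} dt)^{1/l}`, with values in `[0, ∞]`. -/
def mixedNorm (s l : ℝ) (Ω : Set E3) (I : Set ℝ) (f : E3 × ℝ → E3) : ℝ≥0∞ :=
  (∫⁻ t in I, (∫⁻ x in Ω, ‖f (x, t)‖ₑ ^ s) ^ (l / s)) ^ (1 / l)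

/-- `f ∈ L_{s,l}(Q₀⁺(R))`. -/
def MemMixed (s l R : ℝ) (f : E3 × ℝ → E3) : Prop :=
  AEStronglyMeasurable f (volume.restrict (halfCylinder R)) ∧
    mixedNorm s l (halfBall R) (timeInterval R) f < ⊤

/-- `(∂_t η)(x, t)`. -/
def timeDeriv (η : E3 × ℝ → E3) (z : E3 × ℝ) : E3 :=
  deriv (fun t => η (z.1, t)) z.2

/-- `(Δ_x η)(x, t)`, the Laplacian in the space variables, componentwise. -/
def spaceLaplacian (η : E3 × ℝ → E3) (z : E3 × ℝ) : E3 :=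
  Laplacian.laplacian (fun x => η (x, z.2)) z.1

/-- Test functions for the half-space problem: smooth up to `x₃ = 0`, compactly supported,
vanishing near and after the final time `t = 0` (but not near the initial time), with
`η₃ = 0` and `∂₃η₁ = ∂₃η₂ = 0` on `x₃ = 0`. -/
structure IsTestFunction (η : E3 × ℝ → E3) : Prop where
  smooth : ContDiff ℝ ∞ η
  compact_support : HasCompactSupport η
  support_subset : tsupport η ⊆ {z | z.2 < 0}
  dirichlet : ∀ x t, x 2 = 0 → η (x, t) 2 = 0
  neumann : ∀ (i : Fin 3), i ≠ 2 → ∀ x t, x 2 = 0 →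
    fderiv ℝ (fun y => η (y, t) i) x (EuclideanSpace.single 2 1) = 0

/-- `u` is a (very weak) solution, of at most polynomial growth, of
`∂_t u - Δu = g` in `{x₃ > 0} × (-R², 0)`, `u₃ = 0` and `∂₃u₁ = ∂₃u₂ = 0` on `x₃ = 0`,
`u = 0` at `t = -R²`. Integrating the equation against a test function by parts twice in `x`
and once in `t`, the two boundary conditions and the initial condition are exactly what makes
all boundary terms vanish. -/
structure SolvesHalfSpaceHeat (R : ℝ) (g u : E3 × ℝ → E3) : Prop where
  growth : ∃ N : ℕ, Integrable (fun z : E3 × ℝ => ((1 + ‖z.1‖) ^ N)⁻¹ • u z)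
    (volume.restrict (halfSpace ×ˢ timeInterval R))
  identity : ∀ η : E3 × ℝ → E3, IsTestFunction η →
    ∫ z in halfSpace ×ˢ timeInterval R,
        inner ℝ (u z) (-timeDeriv η z - spaceLaplacian η z) =
      ∫ z in halfSpace ×ˢ timeInterval R, inner ℝ (g z) (η z)

/-- `h` is, on `Q₀⁺(R)`, the solution of the heat equation with right-hand side `f`, zero
initial data and `h₃ = 0`, `∂₃h₁ = ∂₃h₂ = 0` on `x₃ = 0`: it is the restriction to `Q₀⁺(R)` of
a solution of the half-space problem in which `f` is continued by zero outside `Q₀⁺(R)`. -/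
def IsHalfCylinderHeatSolution (R : ℝ) (f h : E3 × ℝ → E3) : Prop :=
  ∃ u : E3 × ℝ → E3, SolvesHalfSpaceHeat R ((halfCylinder R).indicator f) u ∧
    h =ᵐ[volume.restrict (halfCylinder R)] u

end

/-! The proof is by duality and works for every very weak solution `u` of polynomial growth, without
uniqueness or a representation formula for `u`. Fix a component i and a smooth φ compactly supported
in the half-cylinder. Extend φ across x₃ = 0 to Φ, oddly if i is the third component and evenly
otherwise, and solve the backward heat equation on the whole space by H(x,t) = ∫_{τ>0} ∫
exp(-|z|²/4) Φ(x - √τ z, t + τ) dz dτ. Then (∂_t + Δ)H = -c₀Φ, where c₀ is the total mass of the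
Gaussian (`heatOp_heatPotential`). H inherits the parity of Φ, so H e_i satisfies the boundary
conditions, and it vanishes near t = 0.

H e_i is not compactly supported, so it is multiplied by a cutoff A(r·). Since H and its spatial
gradient decay faster than any power of |x| while `u` grows at most polynomially in the integral
sense, the commutator terms are O(r). Letting r tend to 0 gives c₀ |∫ u_i φ| ≤ ∫ |f| |H|
(`integral_component_mul_le`).

The right side is controlled at each fixed time by Young's inequality for the exponents 3/2, 6/5, 2.
The heat kernel at elapsed time τ has L_{6/5} norm of order τ^{-1/4}, whose square integrates over
(0,R²) to a multiple of R; hence the factor R^{1/2} (`trilinear_heat_estimate_aux`). The bound is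
uniform in t, so integration in time needs only the L₁ norm in t of f. Finally
`eLpNorm_two_le_of_duality` turns the bound on ∫ u_i φ into an L₂ bound for u_i, which is known
beforehand only to be integrable on the half-cylinder. -/

/-! ### Gaussian moments and Gaussian integration by parts. -/

theorem one_add_pow_mul_exp_le (N : ℕ) {b r : ℝ} (hb : 0 < b) (hr : 0 ≤ r) :
    (1 + r) ^ N * Real.exp (-b * r ^ 2) ≤ N.factorial * Real.exp (1 + 1 / (4 * b)) := by
  have h1 : (1 + r) ^ N ≤ N.factorial * Real.exp (1 + r) := by
    have := Real.pow_div_factorial_le_exp (1 + r) (by positivity) N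
    rwa [div_le_iff₀ (by positivity), mul_comm] at this
  calc (1 + r) ^ N * Real.exp (-b * r ^ 2)
      ≤ N.factorial * Real.exp (1 + r) * Real.exp (-b * r ^ 2) := by gcongr
    _ = N.factorial * Real.exp (1 + r + -b * r ^ 2) := by rw [mul_assoc, ← Real.exp_add]
    _ ≤ _ := by
      refine mul_le_mul_of_nonneg_left (Real.exp_le_exp.2 ?_) (by positivity)
      -- Completing the square in r; the constant 1 + 1/(4b) is the maximum of 1 + r - b r².
      have : 1 + 1 / (4 * b) - (1 + r + -b * r ^ 2) = (2 * b * r - 1) ^ 2 / (4 * b) := by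
        field_simp; ring
      have h2 : 0 ≤ (2 * b * r - 1) ^ 2 / (4 * b) := by positivity
      linarith

theorem integrable_one_add_norm_pow_mul_exp (N : ℕ) {b : ℝ} (hb : 0 < b) :
    Integrable (fun z : E3 => (1 + ‖z‖) ^ N * Real.exp (-b * ‖z‖ ^ 2)) := by
  have h := (integrable_one_add_norm (E := E3) (μ := volume) (r := 4)
    (by simp; norm_num)).const_mul ((N + 4).factorial * Real.exp (1 + 1 / (4 * b)))
  refine h.mono' (by fun_prop) (ae_of_all _ fun z => ?_)
  -- The four spare powers leave (1+|z|)^{-4}, integrable in dimension 3.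
  have h1 := one_add_pow_mul_exp_le (N + 4) hb (norm_nonneg z)
  have h0 : (0 : ℝ) < 1 + ‖z‖ := by positivity
  rw [Real.norm_of_nonneg (by positivity), Real.rpow_neg h0.le]
  norm_cast
  rw [← div_eq_mul_inv, le_div_iff₀ (by positivity)]
  refine le_trans (le_of_eq ?_) h1
  rw [pow_add]; ring

/-- The Gaussian profile `exp(-|z|²/4)` of the heat kernel. -/
noncomputable def gauss (z : E3) : ℝ := Real.exp (-(1 / 4) * ‖z‖ ^ 2)

theorem gauss_pos (z : E3) : 0 < gauss z := Real.exp_pos _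

theorem continuous_gauss : Continuous gauss := by unfold gauss; fun_prop

theorem contDiff_gauss {n : ℕ∞} : ContDiff ℝ n gauss := by
  unfold gauss
  exact (contDiff_const.mul (contDiff_norm_sq ℝ)).exp

theorem fderiv_gauss (z v : E3) : fderiv ℝ gauss z v = -(1 / 2) * inner ℝ z v * gauss z := by
  have h : HasFDerivAt gauss _ z :=
    (((hasStrictFDerivAt_norm_sq z).hasFDerivAt).const_mul (-(1 / 4) : ℝ)).exp
  rw [h.fderiv]
  simp [gauss]
  ring

/-- The unnormalized Gaussian measure `exp(-|z|²/4) dz`. -/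
noncomputable def gaussMeasure : Measure E3 :=
  volume.withDensity fun z => ENNReal.ofReal (gauss z)

theorem measurable_ofReal_gauss : Measurable (fun z => ENNReal.ofReal (gauss z)) :=
  continuous_gauss.measurable.ennreal_ofReal

theorem integral_gaussMeasure {F : Type*} [NormedAddCommGroup F] [NormedSpace ℝ F] (g : E3 → F) :
    ∫ z, g z ∂gaussMeasure = ∫ z, gauss z • g z := by
  rw [gaussMeasure, integral_withDensity_eq_integral_toReal_smul measurable_ofReal_gauss (by simp)]
  simp only [ENNReal.toReal_ofReal (gauss_pos _).le]

theorem integrable_gaussMeasure {g : E3 → ℝ} :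
    Integrable g gaussMeasure ↔ Integrable (fun z => gauss z * g z) := by
  rw [gaussMeasure, integrable_withDensity_iff_integrable_smul' measurable_ofReal_gauss (by simp)]
  simp only [ENNReal.toReal_ofReal (gauss_pos _).le, smul_eq_mul]

theorem lintegral_gaussMeasure {g : E3 → ℝ≥0∞} (hg : Measurable g) :
    ∫⁻ z, g z ∂gaussMeasure = ∫⁻ z, ENNReal.ofReal (gauss z) * g z := by
  rw [gaussMeasure, lintegral_withDensity_eq_lintegral_mul _ measurable_ofReal_gauss hg]
  rfl

theorem integrable_one_add_norm_pow_gaussMeasure (N : ℕ) :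
    Integrable (fun z => (1 + ‖z‖) ^ N) gaussMeasure := by
  rw [integrable_gaussMeasure]
  simpa only [gauss, mul_comm] using
    integrable_one_add_norm_pow_mul_exp N (b := 1 / 4) (by norm_num)

instance : IsFiniteMeasure gaussMeasure := by
  have := integrable_one_add_norm_pow_gaussMeasure 0
  simp only [pow_zero] at this
  rwa [integrable_const_iff_isFiniteMeasure one_ne_zero] at this

theorem gaussMeasure_real_univ_pos : 0 < gaussMeasure.real univ := by
  have h : gaussMeasure.real univ = ∫ z, gauss z := by
    have := integral_gaussMeasure (fun _ => (1 : ℝ))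
    simpa using this
  rw [h, integral_pos_iff_support_of_nonneg (fun z => (gauss_pos z).le)]
  · have : Function.support gauss = univ := by
      ext z; simp [(gauss_pos z).ne']
    rw [this]; simp
  · refine (integrable_one_add_norm_pow_mul_exp 0 (b := 1 / 4) (by norm_num)).congr ?_
    exact ae_of_all _ fun z => by simp [gauss]

/-- Gaussian integration by parts. -/
theorem integral_inner_mul_gaussMeasure {ψ : E3 → ℝ} (hψ : ContDiff ℝ 1 ψ) {C : ℝ}
    (h0 : ∀ z, |ψ z| ≤ C) (h1 : ∀ z, ‖fderiv ℝ ψ z‖ ≤ C) (v : E3) :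
    ∫ z, inner ℝ z v * ψ z ∂gaussMeasure = 2 * ∫ z, fderiv ℝ ψ z v ∂gaussMeasure := by
  have hC : 0 ≤ C := (abs_nonneg _).trans (h0 0)
  have hc1 : Continuous fun z => fderiv ℝ ψ z v :=
    (hψ.continuous_fderiv (by norm_num)).clm_apply continuous_const
  have hcψ := hψ.continuous
  have hI0 : Integrable ψ gaussMeasure :=
    (integrable_const C).mono' hcψ.aestronglyMeasurable (ae_of_all _ h0)
  have hI1 : Integrable (fun z => fderiv ℝ ψ z v) gaussMeasure := by
    refine (integrable_const (C * ‖v‖)).mono' hc1.aestronglyMeasurable (ae_of_all _ fun z => ?_)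
    exact (ContinuousLinearMap.le_opNorm _ _).trans (by gcongr; exact h1 z)
  have hI2 : Integrable (fun z => inner ℝ z v * ψ z) gaussMeasure := by
    refine ((integrable_one_add_norm_pow_gaussMeasure 1).const_mul (‖v‖ * C)).mono'
      (by fun_prop) (ae_of_all _ fun z => ?_)
    rw [norm_mul]
    have : ‖inner ℝ z v‖ ≤ ‖z‖ * ‖v‖ := norm_inner_le_norm z v
    calc _ ≤ (‖z‖ * ‖v‖) * C := by gcongr; exact h0 z
      _ ≤ _ := by nlinarith [mul_nonneg (norm_nonneg v) hC]
  -- Ordinary integration by parts against the density, whose gradient is -(z/2) times itself; this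
  -- gives the factor 2.
  have key := integral_mul_fderiv_eq_neg_fderiv_mul_of_integrable (μ := (volume : Measure E3))
    (f := ψ) (g := gauss) (v := v)
    (by simpa only [mul_comm] using integrable_gaussMeasure.1 hI1)
    (by
      have := (integrable_gaussMeasure.1 hI2).const_mul (-(1 / 2))
      refine this.congr (ae_of_all _ fun z => ?_)
      simp only [fderiv_gauss]; ring)
    (by simpa only [mul_comm] using integrable_gaussMeasure.1 hI0)
    (fun x _ => hψ.differentiable (by norm_num) x)
    (fun x _ => (contDiff_gauss (n := 1)).differentiable (by norm_num) x)
  rw [integral_gaussMeasure, integral_gaussMeasure]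
  have e1 : ∫ z, ψ z * fderiv ℝ gauss z v
      = -(1 / 2) * ∫ z, gauss z • (inner ℝ z v * ψ z) := by
    rw [← integral_const_mul]
    refine integral_congr_ae (ae_of_all _ fun z => ?_)
    simp only [fderiv_gauss, smul_eq_mul]; ring
  have e2 : ∫ z, fderiv ℝ ψ z v * gauss z = ∫ z, gauss z • fderiv ℝ ψ z v := by
    simp only [smul_eq_mul, mul_comm]
  rw [e1, e2] at key
  linarith

/-! ### The backward heat potential: smoothness, causality, spatial decay. -/

/-- Half-line in the elapsed time, times the Gaussian measure. -/
noncomputable def heatMeasure : Measure (E3 × ℝ) := gaussMeasure.prod (volume.restrict (Ioi 0))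

/-- `(z, τ) ↦ (√τ z, -τ)`. -/
noncomputable def heatShift (q : E3 × ℝ) : E3 × ℝ := (√q.2 • q.1, -q.2)

theorem continuous_heatShift : Continuous heatShift := by unfold heatShift; fun_prop

/-- The backward heat potential
`(x, t) ↦ ∫_{τ > 0} ∫ exp(-|z|²/4) Φ(x - √τ z, t + τ) dz dτ`. -/
noncomputable def heatPotential {F : Type*} [NormedAddCommGroup F] [NormedSpace ℝ F]
    (Φ : E3 × ℝ → F) (p : E3 × ℝ) : F :=
  ∫ q, Φ (p - heatShift q) ∂heatMeasure

instance : SFinite heatMeasure := by unfold heatMeasure; infer_instance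

theorem HasCompactSupport.exists_time_bound {F : Type*} [NormedAddCommGroup F]
    {Φ : E3 × ℝ → F} (h : HasCompactSupport Φ) :
    ∃ M : ℝ, 0 < M ∧ ∀ p, Φ p ≠ 0 → ‖p.1‖ ≤ M ∧ |p.2| ≤ M := by
  obtain ⟨M, hM⟩ := h.isCompact.isBounded.exists_norm_le
  refine ⟨max M 1, by positivity, fun p hp => ?_⟩
  have := hM p (subset_tsupport _ hp)
  exact ⟨(norm_fst_le p).trans (this.trans (le_max_left _ _)),
    (norm_snd_le p).trans (this.trans (le_max_left _ _))⟩

theorem ae_heatMeasure_pos : ∀ᵐ q ∂heatMeasure, 0 < q.2 :=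
  Measure.quasiMeasurePreserving_snd.ae (ae_restrict_mem measurableSet_Ioi)

theorem integrable_heatMeasure_weight (N : ℕ) (C T : ℝ) :
    Integrable (fun q : E3 × ℝ => (1 + ‖q.1‖) ^ N * (Iic T).indicator (fun _ => C) q.2)
      heatMeasure := by
  refine (integrable_one_add_norm_pow_gaussMeasure N).mul_prod (g := (Iic T).indicator
    (fun _ => C)) (ν := volume.restrict (Ioi 0)) ?_
  rw [integrable_indicator_iff measurableSet_Iic, IntegrableOn,
    Measure.restrict_restrict measurableSet_Iic]
  have : Iic T ∩ Ioi 0 = Ioc 0 T := by ext; simp [and_comm]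
  rw [this]
  exact integrable_const C

section Potential

variable {F : Type} [NormedAddCommGroup F] {Φ : E3 × ℝ → F}

/-- The time coordinate of `p - heatShift q` is t + τ, which leaves the support of Φ once τ > M +
|t|. The trivial zeroth power puts the bound in the form of `integrable_heatMeasure_weight`. -/
theorem norm_comp_heatShift_le {C M : ℝ} (hC : ∀ q, ‖Φ q‖ ≤ C)
    (hM : ∀ q, Φ q ≠ 0 → ‖q.1‖ ≤ M ∧ |q.2| ≤ M) (p q : E3 × ℝ) :
    ‖Φ (p - heatShift q)‖ ≤ (1 + ‖q.1‖) ^ 0 *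
      (Iic (M + |p.2|)).indicator (fun _ => C) q.2 := by
  rw [pow_zero, one_mul]
  by_cases h : Φ (p - heatShift q) = 0
  · rw [h, norm_zero]
    exact indicator_nonneg (fun _ _ => (norm_nonneg _).trans (hC 0)) _
  · have h1 := (abs_le.1 (hM _ h).2).2
    simp only [heatShift, Prod.snd_sub] at h1
    rw [indicator_of_mem]
    · exact hC _
    · rw [mem_Iic]; linarith [neg_abs_le p.2]

theorem aestronglyMeasurable_comp_heatShift (hΦ : Continuous Φ) (p : E3 × ℝ) :
    AEStronglyMeasurable (fun q => Φ (p - heatShift q)) heatMeasure :=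
  (hΦ.comp (continuous_const.sub continuous_heatShift)).aestronglyMeasurable

theorem integrable_comp_heatShift (hΦ : Continuous Φ) (hs : HasCompactSupport Φ) (p : E3 × ℝ) :
    Integrable (fun q => Φ (p - heatShift q)) heatMeasure := by
  obtain ⟨C, hC⟩ := hs.exists_bound_of_continuous hΦ
  obtain ⟨M, -, hM⟩ := hs.exists_time_bound
  exact (integrable_heatMeasure_weight 0 C (M + |p.2|)).mono'
    (aestronglyMeasurable_comp_heatShift hΦ p)
    (ae_of_all _ fun q => norm_comp_heatShift_le hC hM p q)

variable [NormedSpace ℝ F]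

/-- The point p enters only through a translation of Φ, so derivatives fall on Φ and the Gaussian is
never differentiated. -/
theorem hasFDerivAt_heatPotential (hΦ : ContDiff ℝ 1 Φ) (hs : HasCompactSupport Φ)
    (p : E3 × ℝ) : HasFDerivAt (heatPotential Φ) (heatPotential (fderiv ℝ Φ) p) p := by
  have hc' : Continuous (fderiv ℝ Φ) := hΦ.continuous_fderiv (by norm_num)
  have hs' : HasCompactSupport (fderiv ℝ Φ) := hs.fderiv ℝ
  obtain ⟨C, hC⟩ := hs'.exists_bound_of_continuous hc'
  obtain ⟨M, -, hM⟩ := hs'.exists_time_bound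
  have hC0 : 0 ≤ C := (norm_nonneg _).trans (hC 0)
  refine hasFDerivAt_integral_of_dominated_of_fderiv_le
    (F := fun p q => Φ (p - heatShift q)) (F' := fun p q => fderiv ℝ Φ (p - heatShift q))
    -- The extra 1 is the radius of the ball in which p varies, so one bound serves all nearby
    -- points.
    (bound := fun q => (1 + ‖q.1‖) ^ 0 * (Iic (M + (|p.2| + 1))).indicator (fun _ => C) q.2)
    (Metric.ball_mem_nhds p one_pos)
    (Filter.Eventually.of_forall fun p => aestronglyMeasurable_comp_heatShift hΦ.continuous p)
    (integrable_comp_heatShift hΦ.continuous hs p)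
    (aestronglyMeasurable_comp_heatShift hc' p) (ae_of_all _ fun q p' hp' => ?_)
    (integrable_heatMeasure_weight 0 C _) (ae_of_all _ fun q p' _ => ?_)
  · refine (norm_comp_heatShift_le hC hM p' q).trans ?_
    rw [pow_zero, one_mul, one_mul]
    refine indicator_le_indicator_of_subset (Iic_subset_Iic.2 ?_) (fun _ => hC0) _
    have h1 : |p'.2 - p.2| < 1 := by
      have := (norm_snd_le (p' - p)).trans_lt (mem_ball_iff_norm.1 hp')
      simpa using this
    have h2 : |p'.2| ≤ |p.2| + |p'.2 - p.2| := by
      simpa using abs_add_le p.2 (p'.2 - p.2)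
    linarith
  · have h := (hΦ.differentiable (by norm_num) (p' - heatShift q)).hasFDerivAt
    have h2 := h.comp p' ((hasFDerivAt_id p').sub_const (heatShift q))
    rwa [ContinuousLinearMap.comp_id] at h2

theorem contDiff_heatPotential (hΦ : ContDiff ℝ ∞ Φ) (hs : HasCompactSupport Φ) :
    ContDiff ℝ ∞ (heatPotential Φ) := by
  rw [contDiff_infty]
  intro n
  induction n generalizing F with
  | zero =>
    exact contDiff_zero.2 (continuous_iff_continuousAt.2 fun p =>
      (hasFDerivAt_heatPotential (hΦ.of_le (by exact_mod_cast le_top)) hs p).continuousAt)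
  | succ n ih =>
    have h := hasFDerivAt_heatPotential (hΦ.of_le (by exact_mod_cast le_top)) hs
    push_cast
    rw [contDiff_succ_iff_fderiv]
    refine ⟨fun p => (h p).differentiableAt, by simp, ?_⟩
    have e : fderiv ℝ (heatPotential Φ) = heatPotential (fderiv ℝ Φ) := funext fun p => (h p).fderiv
    rw [e]
    exact ih (hΦ.fderiv_right (by exact_mod_cast le_top)) (hs.fderiv ℝ)

/-- The directional derivative `∂_v Φ`. -/
noncomputable def dirDeriv (v : E3 × ℝ) (Φ : E3 × ℝ → F) (p : E3 × ℝ) : F := fderiv ℝ Φ p v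

theorem contDiff_dirDeriv (v : E3 × ℝ) (hΦ : ContDiff ℝ ∞ Φ) : ContDiff ℝ ∞ (dirDeriv v Φ) :=
  (hΦ.fderiv_right (m := ∞) (by exact_mod_cast le_top)).clm_apply contDiff_const

theorem HasCompactSupport.dirDeriv (v : E3 × ℝ) (hs : HasCompactSupport Φ) :
    HasCompactSupport (dirDeriv v Φ) :=
  (hs.fderiv ℝ).comp_left (g := fun L : E3 × ℝ →L[ℝ] F => L v) (by simp)

theorem dirDeriv_heatPotential [CompleteSpace F] (v : E3 × ℝ) (hΦ : ContDiff ℝ ∞ Φ)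
    (hs : HasCompactSupport Φ) :
    dirDeriv v (heatPotential Φ) = heatPotential (dirDeriv v Φ) := by
  have hΦ1 : ContDiff ℝ 1 Φ := hΦ.of_le (by exact_mod_cast le_top)
  funext p
  rw [dirDeriv, (hasFDerivAt_heatPotential hΦ1 hs p).fderiv, heatPotential,
    ContinuousLinearMap.integral_apply
      (integrable_comp_heatShift (hΦ1.continuous_fderiv (by norm_num)) (hs.fderiv ℝ) p)]
  rfl

/-- Spatial unit vectors in space-time. -/
noncomputable def spaceVec (k : Fin 3) : E3 × ℝ := (EuclideanSpace.single k 1, 0)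

/-- The backward heat operator `∂_t + Δ`. -/
noncomputable def heatOp (Φ : E3 × ℝ → F) (p : E3 × ℝ) : F :=
  dirDeriv (0, 1) Φ p + ∑ k : Fin 3, dirDeriv (spaceVec k) (dirDeriv (spaceVec k) Φ) p

/-- The potential at time t sees Φ only at later times t + τ. -/
theorem heatPotential_eq_zero {δ : ℝ} (h : ∀ q, δ < q.2 → Φ q = 0) {p : E3 × ℝ}
    (hp : δ < p.2) : heatPotential Φ p = 0 := by
  refine integral_eq_zero_of_ae ?_
  filter_upwards [ae_heatMeasure_pos] with q hq
  exact h _ (by simp [heatShift]; linarith)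

/-- Where the integrand is nonzero, τ ≤ S and |x| ≤ M + √S |z|. Thus the weight in x is dominated by
the same power of 1 + |z|, which the Gaussian absorbs. The lower bound on time is what bounds τ. -/
theorem exists_heatPotential_decay (hΦ : Continuous Φ) (hs : HasCompactSupport Φ) (N : ℕ) (T : ℝ) :
    ∃ C, ∀ p : E3 × ℝ, -T < p.2 → ‖heatPotential Φ p‖ * (1 + ‖p.1‖) ^ N ≤ C := by
  obtain ⟨C, hC⟩ := hs.exists_bound_of_continuous hΦ
  obtain ⟨M, hM0, hM⟩ := hs.exists_time_bound
  have hC0 : 0 ≤ C := (norm_nonneg _).trans (hC 0)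
  set S := M + T
  set K := C * ((1 + M) * (1 + √S)) ^ N
  have hK : 0 ≤ K := by positivity
  refine ⟨∫ q, (1 + ‖q.1‖) ^ N * (Iic S).indicator (fun _ => K) q.2 ∂heatMeasure,
    fun p hp => ?_⟩
  have h0 : ‖heatPotential Φ p‖ * (1 + ‖p.1‖) ^ N
      ≤ ∫ q, ‖Φ (p - heatShift q)‖ * (1 + ‖p.1‖) ^ N ∂heatMeasure := by
    rw [integral_mul_const]
    gcongr
    exact norm_integral_le_integral_norm _
  refine h0.trans (integral_mono_of_nonneg (ae_of_all _ fun q => by positivity)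
    (integrable_heatMeasure_weight N K S) (ae_of_all _ fun q => ?_))
  dsimp only
  by_cases h : Φ (p - heatShift q) = 0
  · rw [h, norm_zero, zero_mul]
    exact mul_nonneg (by positivity) (indicator_nonneg (fun _ _ => hK) _)
  · obtain ⟨h1, h2⟩ := hM _ h
    simp only [heatShift, Prod.snd_sub, Prod.fst_sub] at h1 h2
    have hq : q.2 ≤ S := by simp only [S]; linarith [(abs_le.1 h2).2]
    rw [indicator_of_mem (by exact hq)]
    have h3 : ‖p.1‖ ≤ M + √S * ‖q.1‖ := by
      calc ‖p.1‖ = ‖(p.1 - √q.2 • q.1) + √q.2 • q.1‖ := by simp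
        _ ≤ ‖p.1 - √q.2 • q.1‖ + ‖√q.2 • q.1‖ := norm_add_le _ _
        _ ≤ M + √S * ‖q.1‖ := by
          rw [norm_smul, Real.norm_of_nonneg (Real.sqrt_nonneg _)]
          gcongr
    have h4 : 1 + ‖p.1‖ ≤ (1 + M) * (1 + √S) * (1 + ‖q.1‖) := by
      have : 0 ≤ √S := Real.sqrt_nonneg _
      have : 0 ≤ ‖q.1‖ := norm_nonneg _
      nlinarith [mul_nonneg hM0.le (Real.sqrt_nonneg S),
        mul_nonneg hM0.le (norm_nonneg q.1),
        mul_nonneg (mul_nonneg hM0.le (Real.sqrt_nonneg S)) (norm_nonneg q.1)]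
    calc ‖Φ (p - heatShift q)‖ * (1 + ‖p.1‖) ^ N
        ≤ C * ((1 + M) * (1 + √S) * (1 + ‖q.1‖)) ^ N := by
          gcongr
          exact hC _
      _ = (1 + ‖q.1‖) ^ N * K := by simp only [K]; rw [mul_pow]; ring

end Potential

/-! ### The potential inverts the backward heat operator. -/

theorem hasDerivAt_sub_heatShift (p : E3 × ℝ) (z : E3) {τ : ℝ} (hτ : 0 < τ) :
    HasDerivAt (fun τ => p - heatShift (z, τ)) (-(1 / (2 * √τ)) • z, (1 : ℝ)) τ := by
  have h := (((Real.hasDerivAt_sqrt hτ.ne').smul_const z).prodMk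
    ((hasDerivAt_id τ).neg)).const_sub p
  have e : (-(1 / (2 * √τ)) • z, (1 : ℝ)) = -((1 / (2 * √τ)) • z, -(1 : ℝ)) := by
    ext <;> simp
  rw [e]
  exact h

theorem clm_spaceVec_sum (L : E3 × ℝ →L[ℝ] ℝ) (z : E3) :
    L (z, 0) = ∑ k, z k * L (spaceVec k) := by
  have hz : (z, (0 : ℝ)) = ∑ k, z k • spaceVec k := by
    ext i
    · fin_cases i <;> simp [spaceVec, Fin.sum_univ_three]
    · simp [spaceVec, Fin.sum_univ_three]
  rw [hz, map_sum]
  simp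

/-- Differentiating Φ(x - √τ z, t + τ) in τ gives ∂_tΦ - (2√τ)^{-1} z·∇Φ. Gaussian integration by
parts replaces z_k by twice the z_k-derivative, which brings out -√τ ∂_k²Φ. The powers of √τ cancel
and the Laplacian remains. -/
theorem hasDerivAt_integral_heatOp {Φ : E3 × ℝ → ℝ} (hΦ : ContDiff ℝ ∞ Φ) (hs : HasCompactSupport Φ)
    (p : E3 × ℝ) {τ : ℝ} (hτ : 0 < τ) :
    HasDerivAt (fun τ => ∫ z, Φ (p - heatShift (z, τ)) ∂gaussMeasure)
      (∫ z, heatOp Φ (p - heatShift (z, τ)) ∂gaussMeasure) τ := by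
  have hc : ∀ (Ψ : E3 × ℝ → ℝ), Continuous Ψ → ∀ τ : ℝ,
      Continuous fun z => Ψ (p - heatShift (z, τ)) := fun Ψ hΨ τ =>
    hΨ.comp (continuous_const.sub (continuous_heatShift.comp (by fun_prop)))
  have hint : ∀ (Ψ : E3 × ℝ → ℝ), Continuous Ψ → HasCompactSupport Ψ → ∀ τ : ℝ,
      Integrable (fun z => Ψ (p - heatShift (z, τ))) gaussMeasure := fun Ψ hΨ hsΨ τ => by
    obtain ⟨C, hC⟩ := hsΨ.exists_bound_of_continuous hΨ
    exact (integrable_const C).mono' (hc Ψ hΨ τ).aestronglyMeasurable (ae_of_all _ fun z => hC _)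
  have hdΦ : Continuous (fderiv ℝ Φ) := hΦ.continuous_fderiv (by simp)
  obtain ⟨C, hC⟩ := (hs.fderiv ℝ).exists_bound_of_continuous hdΦ
  have hC0 : 0 ≤ C := (norm_nonneg _).trans (hC 0)
  set F' : ℝ → E3 → ℝ := fun τ z =>
    fderiv ℝ Φ (p - heatShift (z, τ)) (-(1 / (2 * √τ)) • z, 1) with hF'
  have hF'c : Continuous (F' τ) := by
    refine (hdΦ.comp (continuous_const.sub (continuous_heatShift.comp ?_))).clm_apply ?_ <;>
      fun_prop
  have key := hasDerivAt_integral_of_dominated_loc_of_deriv_le (μ := gaussMeasure)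
    -- Staying above τ/2 keeps the singular factor 1/(2√σ) bounded.
    (F := fun τ z => Φ (p - heatShift (z, τ))) (F' := F') (x₀ := τ) (s := Ioi (τ / 2))
    (bound := fun z => C * (1 + 1 / (2 * √(τ / 2))) * (1 + ‖z‖) ^ 1)
    (Ioi_mem_nhds (by linarith))
    (Filter.Eventually.of_forall fun τ => (hc Φ hΦ.continuous τ).aestronglyMeasurable)
    (hint Φ hΦ.continuous hs τ) hF'c.aestronglyMeasurable
    (ae_of_all _ fun z σ hσ => ?_)
    ((integrable_one_add_norm_pow_gaussMeasure 1).const_mul _)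
    (ae_of_all _ fun z σ hσ => ?_)
  · suffices hsuf : ∫ z, heatOp Φ (p - heatShift (z, τ)) ∂gaussMeasure
        = ∫ z, F' τ z ∂gaussMeasure by rw [hsuf]; exact key.2
    symm
    have e1 : ∀ z, F' τ z = dirDeriv (0, 1) Φ (p - heatShift (z, τ)) + ∑ k : Fin 3,
        -(1 / (2 * √τ)) * (inner ℝ z (EuclideanSpace.single k (1 : ℝ))
          * dirDeriv (spaceVec k) Φ (p - heatShift (z, τ))) := by
      intro z
      have : ((-(1 / (2 * √τ)) • z, 1) : E3 × ℝ) = (0, 1) + -(1 / (2 * √τ)) • (z, 0) := by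
        ext <;> simp
      simp only [hF', this]
      rw [map_add, map_smul, clm_spaceVec_sum, smul_eq_mul, Finset.mul_sum]
      simp [dirDeriv, EuclideanSpace.inner_single_right]
    have e2 : ∀ k : Fin 3, ∫ z, inner ℝ z (EuclideanSpace.single k (1 : ℝ))
          * dirDeriv (spaceVec k) Φ (p - heatShift (z, τ)) ∂gaussMeasure
        = 2 * (-√τ * ∫ z, dirDeriv (spaceVec k) (dirDeriv (spaceVec k) Φ)
            (p - heatShift (z, τ)) ∂gaussMeasure) := by
      intro k
      have hD := contDiff_dirDeriv (spaceVec k) hΦ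
      have hDs := hs.dirDeriv (spaceVec k)
      have hfd : ∀ z, HasFDerivAt (fun z => dirDeriv (spaceVec k) Φ (p - heatShift (z, τ)))
          ((fderiv ℝ (dirDeriv (spaceVec k) Φ) (p - heatShift (z, τ))).comp
            (-((√τ • ContinuousLinearMap.id ℝ E3).prod (0 : E3 →L[ℝ] ℝ)))) z := by
        intro z
        refine HasFDerivAt.comp z (hD.differentiable (by simp) _).hasFDerivAt ?_
        exact ((((hasFDerivAt_id z).const_smul √τ)).prodMk
          (hasFDerivAt_const (-τ) z)).const_sub p
      obtain ⟨A, hA⟩ := hDs.exists_bound_of_continuous hD.continuous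
      have hDc : Continuous (fderiv ℝ (dirDeriv (spaceVec k) Φ)) :=
        hD.continuous_fderiv (by simp)
      obtain ⟨B, hB⟩ := (hDs.fderiv ℝ).exists_bound_of_continuous hDc
      have hB0 : 0 ≤ B := (norm_nonneg _).trans (hB 0)
      set L : E3 →L[ℝ] (E3 × ℝ) := -((√τ • ContinuousLinearMap.id ℝ E3).prod (0 : E3 →L[ℝ] ℝ)) with hL
      rw [integral_inner_mul_gaussMeasure (C := max A (B * ‖L‖)) ?_
        (fun z => (hA _).trans (le_max_left _ _)) (fun z => ?_)]
      · rw [← integral_const_mul (-√τ)]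
        congr 1
        refine integral_congr_ae (ae_of_all _ fun z => ?_)
        dsimp only
        rw [(hfd z).fderiv]
        have : L (EuclideanSpace.single k 1) = -√τ • spaceVec k := by
          ext <;> simp [hL, spaceVec]
        rw [ContinuousLinearMap.comp_apply, this, map_smul]
        rfl
      · refine (hD.of_le (by exact_mod_cast le_top)).comp ?_
        exact contDiff_const.sub
          ((by fun_prop : ContDiff ℝ 1 fun z : E3 => √τ • z).prodMk
            (contDiff_const (c := -τ)))
      · rw [(hfd z).fderiv]
        refine (ContinuousLinearMap.opNorm_comp_le _ _).trans (le_trans ?_ (le_max_right _ _))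
        gcongr
        exact hB _
    have i0 := hint _ (contDiff_dirDeriv (0, 1) hΦ).continuous (hs.dirDeriv (0, 1)) τ
    have i1 : ∀ k, Integrable (fun z => inner ℝ z (EuclideanSpace.single k (1 : ℝ))
          * dirDeriv (spaceVec k) Φ (p - heatShift (z, τ))) gaussMeasure := by
      intro k
      obtain ⟨A, hA⟩ := (hs.dirDeriv (spaceVec k)).exists_bound_of_continuous
        (contDiff_dirDeriv (spaceVec k) hΦ).continuous
      refine ((integrable_one_add_norm_pow_gaussMeasure 1).const_mul A).mono'
        ((by fun_prop : Continuous fun z : E3 => inner ℝ z (EuclideanSpace.single k (1 : ℝ))).mul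
          (hc _ (contDiff_dirDeriv (spaceVec k) hΦ).continuous τ)).aestronglyMeasurable
        (ae_of_all _ fun z => ?_)
      rw [norm_mul, mul_comm]
      have h1 : ‖inner ℝ z (EuclideanSpace.single k (1 : ℝ))‖ ≤ ‖z‖ * 1 := by
        simpa using norm_inner_le_norm (𝕜 := ℝ) z (EuclideanSpace.single k (1 : ℝ))
      have h2 := (norm_nonneg _).trans (hA 0)
      calc _ ≤ A * (‖z‖ * 1) := by gcongr; exact hA _
        _ ≤ _ := by gcongr; simp
    have i2 := fun k => hint _ (contDiff_dirDeriv (spaceVec k)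
      (contDiff_dirDeriv (spaceVec k) hΦ)).continuous ((hs.dirDeriv (spaceVec k)).dirDeriv _) τ
    rw [integral_congr_ae (ae_of_all _ e1), integral_add i0 (integrable_finsetSum _ fun k _ => (i1 k).const_mul _),
      integral_finsetSum _ fun k _ => (i1 k).const_mul _]
    simp only [integral_const_mul, e2]
    symm
    unfold heatOp
    rw [integral_add i0 (integrable_finsetSum _ fun k _ => i2 k),
      integral_finsetSum _ fun k _ => i2 k]
    congr 1
    refine Finset.sum_congr rfl fun k _ => ?_
    have : √τ ≠ 0 := (Real.sqrt_pos.2 hτ).ne'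
    field_simp
  · have hσ0 : τ / 2 < σ := hσ
    have hs2 : √(τ / 2) ≤ √σ := Real.sqrt_le_sqrt hσ0.le
    have hs0 : 0 < √(τ / 2) := Real.sqrt_pos.2 (by linarith)
    refine (ContinuousLinearMap.le_opNorm _ _).trans ?_
    rw [mul_assoc]
    refine mul_le_mul (hC _) ?_ (norm_nonneg _) hC0
    rw [Prod.norm_def, norm_smul, norm_one, norm_neg, Real.norm_of_nonneg (by positivity)]
    have h1 : 1 / (2 * √σ) ≤ 1 / (2 * √(τ / 2)) := by gcongr
    have h2 : 0 ≤ 1 / (2 * √(τ / 2)) := by positivity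
    refine max_le ?_ ?_
    · calc 1 / (2 * √σ) * ‖z‖ ≤ 1 / (2 * √(τ / 2)) * ‖z‖ := by gcongr
        _ ≤ _ := by nlinarith [norm_nonneg z]
    · nlinarith [norm_nonneg z, mul_nonneg h2 (norm_nonneg z)]
  · have hσ0 : 0 < σ := lt_trans (by linarith) (show τ / 2 < σ from hσ)
    exact ((hΦ.differentiable (by simp) _).hasFDerivAt).comp_hasDerivAt σ
      (hasDerivAt_sub_heatShift p z hσ0)

/-- By the previous derivative formula the integral over τ is that of an exact derivative. The
Gaussian average of Φ vanishes for large τ and equals c₀Φ(p) at τ = 0. -/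
theorem heatPotential_heatOp {Φ : E3 × ℝ → ℝ} (hΦ : ContDiff ℝ ∞ Φ) (hs : HasCompactSupport Φ)
    (p : E3 × ℝ) : heatPotential (heatOp Φ) p = -(gaussMeasure.real univ * Φ p) := by
  have hop : Continuous (heatOp Φ) :=
    (contDiff_dirDeriv _ hΦ).continuous.add (continuous_finsetSum _ fun k _ =>
      (contDiff_dirDeriv _ (contDiff_dirDeriv _ hΦ)).continuous)
  have hops : HasCompactSupport (heatOp Φ) := by
    have h : ∀ k, HasCompactSupport (dirDeriv (spaceVec k) (dirDeriv (spaceVec k) Φ)) :=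
      fun k => (hs.dirDeriv _).dirDeriv _
    have e : heatOp Φ = dirDeriv (0, 1) Φ +
        (dirDeriv (spaceVec 0) (dirDeriv (spaceVec 0) Φ) +
          dirDeriv (spaceVec 1) (dirDeriv (spaceVec 1) Φ) +
          dirDeriv (spaceVec 2) (dirDeriv (spaceVec 2) Φ)) := by
      funext q; simp [heatOp, Fin.sum_univ_three]
    rw [e]
    exact (hs.dirDeriv _).add (((h 0).add (h 1)).add (h 2))
  have hint := integrable_comp_heatShift hop hops p
  obtain ⟨C, hC⟩ := hs.exists_bound_of_continuous hΦ.continuous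
  obtain ⟨M, hM0, hM⟩ := hs.exists_time_bound
  have hm : Continuous fun τ => ∫ z, Φ (p - heatShift (z, τ)) ∂gaussMeasure := by
    refine continuous_of_dominated (bound := fun _ => C) (fun τ => ?_)
      (fun τ => ae_of_all _ fun z => hC _) (integrable_const C) (ae_of_all _ fun z => ?_)
    · exact (hΦ.continuous.comp (continuous_const.sub
        (continuous_heatShift.comp (by fun_prop)))).aestronglyMeasurable
    · exact hΦ.continuous.comp (continuous_const.sub (continuous_heatShift.comp (by fun_prop)))
  have h0 : Filter.Tendsto (fun τ => ∫ z, Φ (p - heatShift (z, τ)) ∂gaussMeasure)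
      Filter.atTop (nhds 0) := by
    refine tendsto_const_nhds.congr' ?_
    filter_upwards [Filter.eventually_gt_atTop (M + |p.2|)] with τ hτ
    symm
    refine integral_eq_zero_of_ae (ae_of_all _ fun z => ?_)
    by_contra h
    have := (abs_le.1 (hM _ h).2).2
    simp only [heatShift, Prod.snd_sub] at this
    linarith [neg_abs_le p.2]
  have key := integral_Ioi_of_hasDerivAt_of_tendsto hm.continuousWithinAt
    (fun τ hτ => hasDerivAt_integral_heatOp hΦ hs p hτ) hint.integral_prod_right h0
  rw [heatPotential, heatMeasure, integral_prod_symm _ hint, key]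
  have : p - (0, 0) = p := sub_zero p
  simp [heatShift, this]

/-! ### The heat kernel estimate pairing L_{3/2} in space with L₂ in space-time. -/

theorem lintegral_comp_sub_smul (h : E3 → ℝ≥0∞) (hh : Measurable h) (x : E3) {c : ℝ}
    (hc : 0 < c) : ∫⁻ z, h (x - c • z) = ENNReal.ofReal ((c ^ 3)⁻¹) * ∫⁻ y, h y := by
  have h1 : ∫⁻ z, h (x - c • z) = ∫⁻ y, h (x - y) ∂(Measure.map (c • ·) (volume : Measure E3)) := by
    rw [lintegral_map (f := fun y => h (x - y)) (by fun_prop) (by fun_prop)]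
  rw [h1, Measure.map_addHaar_smul _ hc.ne', lintegral_smul_measure, lintegral_sub_left_eq_self]
  simp [abs_of_pos hc]

theorem lintegral_gauss_rpow_lt_top :
    ∫⁻ z, ENNReal.ofReal (gauss z) ^ (6 / 5 : ℝ) < ⊤ := by
  have h := integrable_one_add_norm_pow_mul_exp 0 (b := 3 / 10) (by norm_num)
  refine lt_of_eq_of_lt (lintegral_congr fun z => ?_) h.hasFiniteIntegral
  dsimp only
  rw [ENNReal.ofReal_rpow_of_pos (gauss_pos z), gauss, ← Real.exp_mul, pow_zero, one_mul,
    ← ofReal_norm, Real.norm_of_nonneg (Real.exp_pos _).le]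
  ring_nf

theorem lintegral_rpow_neg_half {R : ℝ} (hR : 0 < R) :
    ∫⁻ τ in Ioo 0 (R ^ 2), ENNReal.ofReal τ ^ (-(1 / 2) : ℝ) = ENNReal.ofReal (2 * R) := by
  have hi : IntervalIntegrable (fun τ : ℝ => τ ^ (-(1 / 2) : ℝ)) volume 0 (R ^ 2) :=
    intervalIntegral.intervalIntegrable_rpow' (by norm_num)
  have h1 : ∫ τ in Ioo 0 (R ^ 2), τ ^ (-(1 / 2) : ℝ) = 2 * R := by
    rw [← integral_Ioc_eq_integral_Ioo, ← intervalIntegral.integral_of_le (by positivity),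
      integral_rpow (by norm_num), Real.zero_rpow (by norm_num)]
    rw [← Real.rpow_natCast, ← Real.rpow_mul hR.le]
    norm_num
    ring
  rw [← h1, ofReal_integral_eq_lintegral_ofReal]
  · refine setLIntegral_congr_fun measurableSet_Ioo fun τ hτ => ?_
    exact ENNReal.ofReal_rpow_of_pos hτ.1
  · exact ((intervalIntegrable_iff_integrableOn_Ioc_of_le (by positivity)).1 hi).mono_set
      Ioo_subset_Ioc_self
  · filter_upwards [ae_restrict_mem measurableSet_Ioo] with τ hτ
    exact Real.rpow_nonneg hτ.1.le _

/-- The constant in the trilinear heat kernel estimate. -/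
noncomputable def heatConst : ℝ≥0∞ :=
  ENNReal.ofReal 2 ^ (1 / 2 : ℝ) *
    (∫⁻ z, ENNReal.ofReal (gauss z) ^ (6 / 5 : ℝ)) ^ (5 / 6 : ℝ)

theorem heatConst_lt_top : heatConst < ⊤ :=
  ENNReal.mul_lt_top (ENNReal.rpow_lt_top_of_nonneg (by norm_num) (by simp))
    (ENNReal.rpow_lt_top_of_nonneg (by norm_num) lintegral_gauss_rpow_lt_top.ne)

theorem rpow_split {a : ℝ≥0∞} {p q : ℝ} (hp : 0 ≤ p) (hq : 0 ≤ q) (hpq : p + q = 1) :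
    a ^ p * a ^ q = a := by
  rw [← ENNReal.rpow_add_of_nonneg _ _ hp hq, hpq, ENNReal.rpow_one]

theorem lintegral_three_holder {α : Type*} [MeasurableSpace α] {μ : Measure α}
    {f g h : α → ℝ≥0∞} (hf : Measurable f) (hg : Measurable g) (hh : Measurable h)
    {p q r : ℝ} (hp : 0 ≤ p) (hq : 0 ≤ q) (hr : 0 ≤ r) (hs : p + q + r = 1) :
    ∫⁻ x, f x ^ p * g x ^ q * h x ^ r ∂μ
      ≤ (∫⁻ x, f x ∂μ) ^ p * (∫⁻ x, g x ∂μ) ^ q * (∫⁻ x, h x ∂μ) ^ r := by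
  have := ENNReal.lintegral_prod_norm_pow_le (μ := μ) (Finset.univ : Finset (Fin 3))
    (f := ![f, g, h]) (p := ![p, q, r])
    (by intro i _; fin_cases i <;> simp [hf.aemeasurable, hg.aemeasurable, hh.aemeasurable])
    (by simp [Fin.sum_univ_three, hs])
    (by intro i _; fin_cases i <;> simp [hp, hq, hr])
  simpa [Fin.prod_univ_three] using this

/-- Young's inequality proved through a three-factor Hölder inequality. With g the Gaussian, agΨ is
split as (a^{3/2} g^{6/5} τ^{-1/2})^{1/2} (g^{6/5} Ψ²)^{1/3} (a^{3/2} τ^{3/2} Ψ²)^{1/6}. The first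
factor separates and its τ-integral is 2R. In the second, the x-integral is translation invariant
for fixed z and τ. In the third, the substitution y = x - √τ z for fixed x has Jacobian τ^{-3/2},
which the weight cancels. -/
theorem trilinear_heat_estimate_aux {R : ℝ} (hR : 0 < R) {μ : Measure E3} [SFinite μ]
    (hμ : μ ≤ volume) {a : E3 → ℝ≥0∞} (ha : Measurable a) {Ψ : E3 × ℝ → ℝ≥0∞}
    (hΨ : Measurable Ψ) (t : ℝ) :
    ∫⁻ w, a w.1 * (ENNReal.ofReal (gauss w.2.1) * Ψ ((w.1, t) - heatShift w.2))
        ∂(μ.prod ((volume : Measure E3).prod (volume.restrict (Ioo 0 (R ^ 2)))))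
      ≤ heatConst * ENNReal.ofReal R ^ (1 / 2 : ℝ) * (∫⁻ x, a x ^ (3 / 2 : ℝ) ∂μ) ^ (2 / 3 : ℝ) *
        (∫⁻ p, Ψ p ^ (2 : ℝ)) ^ (1 / 2 : ℝ) := by
  set ν : Measure ℝ := volume.restrict (Ioo 0 (R ^ 2)) with hν
  set G : ℝ≥0∞ := ∫⁻ z, ENNReal.ofReal (gauss z) ^ (6 / 5 : ℝ) with hG
  set α := ∫⁻ x, a x ^ (3 / 2 : ℝ) ∂μ with hα
  set P := ∫⁻ p, Ψ p ^ (2 : ℝ) with hP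
  have hΨ2 : Measurable fun p => Ψ p ^ (2 : ℝ) := hΨ.pow_const _
  have hsh : Measurable fun w : E3 × E3 × ℝ => (w.1, t) - heatShift w.2 :=
    (Continuous.sub (by fun_prop) (continuous_heatShift.comp (by fun_prop))).measurable
  have hg : Measurable fun w : E3 × E3 × ℝ => ENNReal.ofReal (gauss w.2.1) ^ (6 / 5 : ℝ) :=
    (measurable_ofReal_gauss.comp (by fun_prop)).pow_const _
  have hg' : Measurable fun z : E3 => ENNReal.ofReal (gauss z) ^ (6 / 5 : ℝ) :=
    measurable_ofReal_gauss.pow_const _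
  have hgt : ∀ z : E3, ENNReal.ofReal (gauss z) ^ (6 / 5 : ℝ) ≠ ⊤ := fun z =>
    ENNReal.rpow_ne_top_of_nonneg (by norm_num) (by simp)
  have ha' : Measurable fun w : E3 × E3 × ℝ => a w.1 ^ (3 / 2 : ℝ) :=
    (ha.comp measurable_fst).pow_const _
  have hA : Measurable fun w : E3 × E3 × ℝ => a w.1 ^ (3 / 2 : ℝ) *
      (ENNReal.ofReal (gauss w.2.1) ^ (6 / 5 : ℝ) * ENNReal.ofReal w.2.2 ^ (-(1 / 2) : ℝ)) :=
    ha'.mul (hg.mul (by fun_prop))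
  have hB : Measurable fun w : E3 × E3 × ℝ => ENNReal.ofReal (gauss w.2.1) ^ (6 / 5 : ℝ) *
      Ψ ((w.1, t) - heatShift w.2) ^ (2 : ℝ) := hg.mul (hΨ2.comp hsh)
  have hC : Measurable fun w : E3 × E3 × ℝ => a w.1 ^ (3 / 2 : ℝ) *
      (ENNReal.ofReal w.2.2 ^ (3 / 2 : ℝ) * Ψ ((w.1, t) - heatShift w.2) ^ (2 : ℝ)) :=
    ha'.mul (Measurable.mul (by fun_prop) (hΨ2.comp hsh))
  have hpos : ∀ᵐ w ∂(μ.prod ((volume : Measure E3).prod ν)), 0 < w.2.2 := by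
    have h1 : ∀ᵐ τ ∂ν, 0 < τ := by
      filter_upwards [ae_restrict_mem measurableSet_Ioo] with τ hτ using hτ.1
    have h2 : ∀ᵐ q ∂((volume : Measure E3).prod ν), 0 < q.2 :=
      Measure.quasiMeasurePreserving_snd.ae h1
    exact Measure.quasiMeasurePreserving_snd.ae h2
  have htime : ∫⁻ τ, (∫⁻ y : E3, Ψ (y, t + τ) ^ (2 : ℝ)) ∂ν ≤ P := by
    calc _ ≤ ∫⁻ τ : ℝ, ∫⁻ y : E3, Ψ (y, t + τ) ^ (2 : ℝ) := lintegral_mono' Measure.restrict_le_self le_rfl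
      _ = ∫⁻ τ : ℝ, ∫⁻ y : E3, Ψ (y, τ) ^ (2 : ℝ) :=
        lintegral_add_left_eq_self (fun τ => ∫⁻ y : E3, Ψ (y, τ) ^ (2 : ℝ)) t
      _ = P := by
        rw [hP, Measure.volume_eq_prod, lintegral_prod_symm _ hΨ2.aemeasurable]
  have IA : ∫⁻ w, a w.1 ^ (3 / 2 : ℝ) * (ENNReal.ofReal (gauss w.2.1) ^ (6 / 5 : ℝ) *
      ENNReal.ofReal w.2.2 ^ (-(1 / 2) : ℝ)) ∂(μ.prod ((volume : Measure E3).prod ν))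
      = α * (G * ENNReal.ofReal (2 * R)) := by
    have h1 : Measurable fun q : E3 × ℝ => ENNReal.ofReal (gauss q.1) ^ (6 / 5 : ℝ) *
        ENNReal.ofReal q.2 ^ (-(1 / 2) : ℝ) :=
      (hg'.comp measurable_fst).mul (by fun_prop)
    have h2 : Measurable fun τ : ℝ => ENNReal.ofReal τ ^ (-(1 / 2) : ℝ) := by fun_prop
    rw [lintegral_prod_mul (ha.pow_const _).aemeasurable h1.aemeasurable,
      lintegral_prod_mul hg'.aemeasurable h2.aemeasurable, lintegral_rpow_neg_half hR]
  have IB : ∫⁻ w, ENNReal.ofReal (gauss w.2.1) ^ (6 / 5 : ℝ) *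
      Ψ ((w.1, t) - heatShift w.2) ^ (2 : ℝ) ∂(μ.prod ((volume : Measure E3).prod ν))
      ≤ G * P := by
    rw [lintegral_prod_symm _ hB.aemeasurable, lintegral_prod]
    · rw [hG, ← lintegral_mul_const _ hg']
      refine lintegral_mono fun z => ?_
      dsimp only
      have : ∀ τ : ℝ, ∫⁻ x, ENNReal.ofReal (gauss z) ^ (6 / 5 : ℝ) *
          Ψ ((x, t) - heatShift (z, τ)) ^ (2 : ℝ) ∂μ ≤
          ENNReal.ofReal (gauss z) ^ (6 / 5 : ℝ) * ∫⁻ y : E3, Ψ (y, t + τ) ^ (2 : ℝ) := by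
        intro τ
        rw [lintegral_const_mul' _ _ (hgt z)]
        refine mul_le_mul' le_rfl ?_
        refine (lintegral_mono' hμ le_rfl).trans (le_of_eq ?_)
        rw [← lintegral_sub_right_eq_self (fun y => Ψ (y, t + τ) ^ (2 : ℝ)) (√τ • z)]
        simp [heatShift]
      refine (lintegral_mono this).trans ?_
      rw [lintegral_const_mul' _ _ (hgt z)]
      exact mul_le_mul' le_rfl htime
    · exact (hB.comp measurable_swap).lintegral_prod_right'.aemeasurable
  have IC : ∫⁻ w, a w.1 ^ (3 / 2 : ℝ) * (ENNReal.ofReal w.2.2 ^ (3 / 2 : ℝ) *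
      Ψ ((w.1, t) - heatShift w.2) ^ (2 : ℝ)) ∂(μ.prod ((volume : Measure E3).prod ν))
      ≤ α * P := by
    rw [lintegral_prod _ hC.aemeasurable, hα, ← lintegral_mul_const _ (ha.pow_const _)]
    refine lintegral_mono fun x => ?_
    have hx : Measurable fun q : E3 × ℝ => Ψ ((x, t) - heatShift q) ^ (2 : ℝ) :=
      hΨ2.comp (continuous_const.sub continuous_heatShift).measurable
    have hx' : Measurable fun q : E3 × ℝ => ENNReal.ofReal q.2 ^ (3 / 2 : ℝ) *
        Ψ ((x, t) - heatShift q) ^ (2 : ℝ) := Measurable.mul (by fun_prop) hx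
    dsimp only
    rw [lintegral_const_mul _ hx']
    refine mul_le_mul' le_rfl ?_
    rw [lintegral_prod_symm _ hx'.aemeasurable]
    refine le_trans (le_of_eq ?_) htime
    refine lintegral_congr_ae ?_
    filter_upwards [ae_restrict_mem measurableSet_Ioo] with τ hτ
    have hτ0 : 0 < τ := hτ.1
    have hs := lintegral_comp_sub_smul (fun y => Ψ (y, t + τ) ^ (2 : ℝ))
      (hΨ2.comp (by fun_prop)) x (Real.sqrt_pos.2 hτ0)
    have e : ∀ z : E3, (x, t) - heatShift (z, τ) = (x - √τ • z, t + τ) := by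
      intro z; simp [heatShift]
    simp only [e]
    rw [lintegral_const_mul' _ _ (ENNReal.rpow_ne_top_of_nonneg (by norm_num) (by simp)), hs,
      ← mul_assoc, ENNReal.ofReal_rpow_of_pos hτ0, ← ENNReal.ofReal_mul (by positivity)]
    have : τ ^ (3 / 2 : ℝ) * (√τ ^ 3)⁻¹ = 1 := by
      rw [Real.sqrt_eq_rpow, ← Real.rpow_natCast, ← Real.rpow_mul hτ0.le]
      norm_num
      exact mul_inv_cancel₀ (Real.rpow_pos_of_pos hτ0 _).ne'
    rw [this]; simp
  calc _ = ∫⁻ w, (a w.1 ^ (3 / 2 : ℝ) * (ENNReal.ofReal (gauss w.2.1) ^ (6 / 5 : ℝ) *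
      ENNReal.ofReal w.2.2 ^ (-(1 / 2) : ℝ))) ^ (1 / 2 : ℝ) *
      (ENNReal.ofReal (gauss w.2.1) ^ (6 / 5 : ℝ) *
        Ψ ((w.1, t) - heatShift w.2) ^ (2 : ℝ)) ^ (1 / 3 : ℝ) *
      (a w.1 ^ (3 / 2 : ℝ) * (ENNReal.ofReal w.2.2 ^ (3 / 2 : ℝ) *
        Ψ ((w.1, t) - heatShift w.2) ^ (2 : ℝ))) ^ (1 / 6 : ℝ)
        ∂(μ.prod ((volume : Measure E3).prod ν)) := by
        refine lintegral_congr_ae ?_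
        filter_upwards [hpos] with w hw
        -- The weights in τ cancel only where τ ≠ 0, hence the almost everywhere argument.
        have hτ : ENNReal.ofReal w.2.2 ^ (-(1 / 4) : ℝ) * ENNReal.ofReal w.2.2 ^ (1 / 4 : ℝ) = 1 := by
          rw [← ENNReal.rpow_add _ _ (by simpa using hw) (by simp)]
          norm_num
        generalize Ψ ((w.1, t) - heatShift w.2) = b
        generalize ENNReal.ofReal (gauss w.2.1) = g
        generalize a w.1 = c
        generalize ENNReal.ofReal w.2.2 = s at hτ
        simp only [ENNReal.mul_rpow_of_nonneg _ _ (show (0 : ℝ) ≤ 1 / 2 by norm_num),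
          ENNReal.mul_rpow_of_nonneg _ _ (show (0 : ℝ) ≤ 1 / 3 by norm_num),
          ENNReal.mul_rpow_of_nonneg _ _ (show (0 : ℝ) ≤ 1 / 6 by norm_num),
          ← ENNReal.rpow_mul]
        norm_num only
        calc c * (g * b) = (c ^ (3 / 4 : ℝ) * c ^ (1 / 4 : ℝ)) *
            ((g ^ (3 / 5 : ℝ) * g ^ (2 / 5 : ℝ)) * (b ^ (2 / 3 : ℝ) * b ^ (1 / 3 : ℝ))) := by
              rw [rpow_split, rpow_split, rpow_split] <;> norm_num
          _ = (c ^ (3 / 4 : ℝ) * c ^ (1 / 4 : ℝ)) *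
            ((g ^ (3 / 5 : ℝ) * g ^ (2 / 5 : ℝ)) * (b ^ (2 / 3 : ℝ) * b ^ (1 / 3 : ℝ))) *
              (s ^ (-(1 / 4) : ℝ) * s ^ (1 / 4 : ℝ)) := by rw [hτ, mul_one]
          _ = _ := by ring
    _ ≤ (α * (G * ENNReal.ofReal (2 * R))) ^ (1 / 2 : ℝ) * (G * P) ^ (1 / 3 : ℝ) *
        (α * P) ^ (1 / 6 : ℝ) := by
        refine (lintegral_three_holder hA hB hC (by norm_num) (by norm_num) (by norm_num)
          (by norm_num)).trans ?_
        rw [IA]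
        gcongr
    _ = _ := by
        rw [heatConst, ← hG, ENNReal.ofReal_mul (by norm_num)]
        simp only [ENNReal.mul_rpow_of_nonneg _ _ (show (0 : ℝ) ≤ 1 / 2 by norm_num),
          ENNReal.mul_rpow_of_nonneg _ _ (show (0 : ℝ) ≤ 1 / 3 by norm_num),
          ENNReal.mul_rpow_of_nonneg _ _ (show (0 : ℝ) ≤ 1 / 6 by norm_num)]
        have e1 : α ^ (2 / 3 : ℝ) = α ^ (1 / 2 : ℝ) * α ^ (1 / 6 : ℝ) := by
          rw [← ENNReal.rpow_add_of_nonneg _ _ (by norm_num) (by norm_num)]; norm_num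
        have e2 : P ^ (1 / 2 : ℝ) = P ^ (1 / 3 : ℝ) * P ^ (1 / 6 : ℝ) := by
          rw [← ENNReal.rpow_add_of_nonneg _ _ (by norm_num) (by norm_num)]; norm_num
        have e3 : G ^ (5 / 6 : ℝ) = G ^ (1 / 2 : ℝ) * G ^ (1 / 3 : ℝ) := by
          rw [← ENNReal.rpow_add_of_nonneg _ _ (by norm_num) (by norm_num)]; norm_num
        rw [e1, e2, e3]
        ring

/-- Since Φ is supported in negative times and t > -R², only elapsed times τ < R² contribute. This
is the only place where the length of the time interval enters the kernel bound. -/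
theorem enorm_heatPotential_le {Φ : E3 × ℝ → ℝ} (hΦ : Continuous Φ)
    (hneg : ∀ p, Φ p ≠ 0 → p.2 < 0) {R : ℝ} {p : E3 × ℝ} (hp : -R ^ 2 < p.2) :
    ‖heatPotential Φ p‖ₑ ≤ ∫⁻ q, ENNReal.ofReal (gauss q.1) * ‖Φ (p - heatShift q)‖ₑ
      ∂((volume : Measure E3).prod (volume.restrict (Ioo 0 (R ^ 2)))) := by
  have hm : Measurable fun q : E3 × ℝ => ‖Φ (p - heatShift q)‖ₑ :=
    (hΦ.comp (continuous_const.sub continuous_heatShift)).enorm.measurable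
  have hm' : Measurable fun q : E3 × ℝ => ENNReal.ofReal (gauss q.1) * ‖Φ (p - heatShift q)‖ₑ :=
    (measurable_ofReal_gauss.comp measurable_fst).mul hm
  refine (enorm_integral_le_lintegral_enorm _).trans ?_
  rw [heatMeasure, lintegral_prod_symm _ hm.aemeasurable, lintegral_prod_symm _ hm'.aemeasurable,
    ← lintegral_indicator measurableSet_Ioi, ← lintegral_indicator measurableSet_Ioo]
  refine lintegral_mono fun τ => ?_
  by_cases h0 : 0 < τ
  · rw [indicator_of_mem (by exact h0), lintegral_gaussMeasure (g := fun z => ‖Φ (p - heatShift (z, τ))‖ₑ)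
      (hm.comp measurable_prodMk_right)]
    by_cases h1 : τ < R ^ 2
    · rw [indicator_of_mem (show τ ∈ Ioo 0 (R ^ 2) from ⟨h0, h1⟩)]
    · refine le_of_eq_of_le ?_ (zero_le)
      refine (lintegral_congr fun z => ?_).trans lintegral_zero
      have : Φ (p - heatShift (z, τ)) = 0 := by
        by_contra h
        have := hneg _ h
        simp only [heatShift, Prod.snd_sub] at this
        linarith
      simp [this]
  · rw [indicator_of_notMem (by exact h0)]
    exact zero_le

theorem trilinear_heat_estimate_of_measurable {R : ℝ} (hR : 0 < R) {μ : Measure E3} [SFinite μ]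
    (hμ : μ ≤ volume) {a : E3 → ℝ≥0∞} (ha : Measurable a) {Φ : E3 × ℝ → ℝ}
    (hΦ : Continuous Φ) (hneg : ∀ p, Φ p ≠ 0 → p.2 < 0) {t : ℝ} (ht : -R ^ 2 < t) :
    ∫⁻ x, a x * ‖heatPotential Φ (x, t)‖ₑ ∂μ
      ≤ heatConst * ENNReal.ofReal R ^ (1 / 2 : ℝ) * (∫⁻ x, a x ^ (3 / 2 : ℝ) ∂μ) ^ (2 / 3 : ℝ) *
        (∫⁻ p, ‖Φ p‖ₑ ^ (2 : ℝ)) ^ (1 / 2 : ℝ) := by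
  have hΨ : Measurable fun p => ‖Φ p‖ₑ := hΦ.enorm.measurable
  have haux := trilinear_heat_estimate_aux hR hμ ha hΨ t
  refine le_trans ?_ haux
  have hsh : Measurable fun w : E3 × E3 × ℝ => (w.1, t) - heatShift w.2 :=
    (Continuous.sub (by fun_prop) (continuous_heatShift.comp (by fun_prop))).measurable
  have hmeas : Measurable fun w : E3 × E3 × ℝ => ENNReal.ofReal (gauss w.2.1) *
      ‖Φ ((w.1, t) - heatShift w.2)‖ₑ :=
    (measurable_ofReal_gauss.comp (by fun_prop)).mul (hΨ.comp hsh)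
  have hmeas' : Measurable fun w : E3 × E3 × ℝ => a w.1 *
      (ENNReal.ofReal (gauss w.2.1) * ‖Φ ((w.1, t) - heatShift w.2)‖ₑ) :=
    (ha.comp measurable_fst).mul hmeas
  rw [lintegral_prod _ hmeas'.aemeasurable]
  refine lintegral_mono fun x => ?_
  dsimp only
  have hx : Measurable fun q : E3 × ℝ => ENNReal.ofReal (gauss q.1) *
      ‖Φ ((x, t) - heatShift q)‖ₑ :=
    (measurable_ofReal_gauss.comp measurable_fst).mul
      (hΨ.comp (continuous_const.sub continuous_heatShift).measurable)
  have hb := enorm_heatPotential_le hΦ hneg (R := R) (p := (x, t)) ht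
  rw [lintegral_const_mul _ hx]
  exact mul_le_mul' le_rfl hb

theorem trilinear_heat_estimate {R : ℝ} (hR : 0 < R) {μ : Measure E3} [SFinite μ]
    (hμ : μ ≤ volume) {a : E3 → ℝ≥0∞} (ha : AEMeasurable a μ) {Φ : E3 × ℝ → ℝ}
    (hΦ : Continuous Φ) (hneg : ∀ p, Φ p ≠ 0 → p.2 < 0) {t : ℝ} (ht : -R ^ 2 < t) :
    ∫⁻ x, a x * ‖heatPotential Φ (x, t)‖ₑ ∂μ
      ≤ heatConst * ENNReal.ofReal R ^ (1 / 2 : ℝ) * (∫⁻ x, a x ^ (3 / 2 : ℝ) ∂μ) ^ (2 / 3 : ℝ) *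
        (∫⁻ p, ‖Φ p‖ₑ ^ (2 : ℝ)) ^ (1 / 2 : ℝ) := by
  obtain ⟨b, hb, hab⟩ := ha
  have e1 : ∫⁻ x, a x * ‖heatPotential Φ (x, t)‖ₑ ∂μ
      = ∫⁻ x, b x * ‖heatPotential Φ (x, t)‖ₑ ∂μ :=
    lintegral_congr_ae (by filter_upwards [hab] with x hx using by rw [hx])
  have e2 : ∫⁻ x, a x ^ (3 / 2 : ℝ) ∂μ = ∫⁻ x, b x ^ (3 / 2 : ℝ) ∂μ :=
    lintegral_congr_ae (by filter_upwards [hab] with x hx using by rw [hx])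
  rw [e1, e2]
  exact trilinear_heat_estimate_of_measurable hR hμ hb hΦ hneg ht

theorem isOpen_halfBall (R : ℝ) : IsOpen (halfBall R) :=
  (isOpen_lt (f := fun x : E3 => ‖x‖) (g := fun _ => R) (by fun_prop) (by fun_prop)).inter
    (isOpen_lt (f := fun _ => (0 : ℝ)) (g := fun x : E3 => x 2) (by fun_prop) (by fun_prop))

theorem isOpen_halfCylinder (R : ℝ) : IsOpen (halfCylinder R) :=
  (isOpen_halfBall R).prod isOpen_Ioo

theorem restrict_halfCylinder (R : ℝ) : (volume : Measure (E3 × ℝ)).restrict (halfCylinder R) =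
    ((volume : Measure E3).restrict (halfBall R)).prod (volume.restrict (timeInterval R)) := by
  rw [Measure.volume_eq_prod, Measure.prod_restrict, halfCylinder]

/-- On each time slice the kernel estimate depends on t only through the L_{3/2} norm of f(·,t), so
integrating in t produces the L_{3/2,1} norm. -/
theorem lintegral_mul_heatPotential_le {R : ℝ} (hR : 0 < R) {f : E3 × ℝ → E3}
    (hf : AEStronglyMeasurable f (volume.restrict (halfCylinder R))) {Φ : E3 × ℝ → ℝ}
    (hΦ : ContDiff ℝ ∞ Φ) (hs : HasCompactSupport Φ) (hneg : ∀ p, Φ p ≠ 0 → p.2 < 0) :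
    ∫⁻ p in halfCylinder R, ‖f p‖ₑ * ‖heatPotential Φ p‖ₑ
      ≤ heatConst * ENNReal.ofReal R ^ (1 / 2 : ℝ) *
        mixedNorm (3 / 2) 1 (halfBall R) (timeInterval R) f *
        (∫⁻ p, ‖Φ p‖ₑ ^ (2 : ℝ)) ^ (1 / 2 : ℝ) := by
  rw [restrict_halfCylinder] at hf ⊢
  have hH := (contDiff_heatPotential hΦ hs).continuous
  have hm : AEMeasurable (fun p => ‖f p‖ₑ * ‖heatPotential Φ p‖ₑ)
      ((volume.restrict (halfBall R)).prod (volume.restrict (timeInterval R))) :=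
    hf.enorm.mul hH.enorm.measurable.aemeasurable
  rw [lintegral_prod_symm _ hm]
  have hsec : ∀ᵐ t ∂(volume.restrict (timeInterval R)),
      AEStronglyMeasurable (fun x => f (x, t)) ((volume : Measure E3).restrict (halfBall R)) :=
    hf.prod_swap.prodMk_left
  calc _ ≤ ∫⁻ t in timeInterval R, heatConst * ENNReal.ofReal R ^ (1 / 2 : ℝ) *
        (∫⁻ x in halfBall R, ‖f (x, t)‖ₑ ^ (3 / 2 : ℝ)) ^ (2 / 3 : ℝ) *
        (∫⁻ p, ‖Φ p‖ₑ ^ (2 : ℝ)) ^ (1 / 2 : ℝ) := by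
        refine lintegral_mono_ae ?_
        filter_upwards [hsec, ae_restrict_mem measurableSet_Ioo] with t h1 h2
        exact trilinear_heat_estimate hR Measure.restrict_le_self h1.enorm hΦ.continuous hneg h2.1
    _ = _ := by
        have hP : (∫⁻ p, ‖Φ p‖ₑ ^ (2 : ℝ)) ^ (1 / 2 : ℝ) ≠ ⊤ := by
          refine ENNReal.rpow_ne_top_of_nonneg (by norm_num) ?_
          have := (hΦ.continuous.memLp_of_hasCompactSupport (p := 2) hs
            (μ := volume)).eLpNorm_lt_top
          rw [eLpNorm_lt_top_iff_lintegral_rpow_enorm_lt_top (by norm_num) (by norm_num)] at this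
          simpa using this.ne
        have hK : heatConst * ENNReal.ofReal R ^ (1 / 2 : ℝ) ≠ ⊤ :=
          ENNReal.mul_ne_top heatConst_lt_top.ne
            (ENNReal.rpow_ne_top_of_nonneg (by norm_num) (by simp))
        rw [lintegral_mul_const' _ _ hP, lintegral_const_mul' _ _ hK, mixedNorm]
        norm_num

/-! ### Product and dilation rules, and the operators of the weak formulation in terms of
directional derivatives. -/

theorem dirDeriv_mul {A B : E3 × ℝ → ℝ} (hA : ContDiff ℝ ∞ A) (hB : ContDiff ℝ ∞ B)
    (v : E3 × ℝ) :
    dirDeriv v (fun p => A p * B p) = fun p => A p * dirDeriv v B p + B p * dirDeriv v A p := by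
  funext p
  have h := ((hA.differentiable (by simp) p).hasFDerivAt.mul
    (hB.differentiable (by simp) p).hasFDerivAt).fderiv
  have h' : fderiv ℝ (fun p => A p * B p) p = _ := h
  simp [dirDeriv, h']

theorem dirDeriv_add {A B : E3 × ℝ → ℝ} (hA : ContDiff ℝ ∞ A) (hB : ContDiff ℝ ∞ B)
    (v : E3 × ℝ) :
    dirDeriv v (fun p => A p + B p) = fun p => dirDeriv v A p + dirDeriv v B p := by
  funext p
  have h := ((hA.differentiable (by simp) p).hasFDerivAt.add
    (hB.differentiable (by simp) p).hasFDerivAt).fderiv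
  have h' : fderiv ℝ (fun p => A p + B p) p = _ := h
  simp [dirDeriv, h']

/-- This isolates A(∂_t + Δ)B; every remaining term carries a derivative of A and is small for a
slowly varying cutoff. -/
theorem heatOp_mul {A B : E3 × ℝ → ℝ} (hA : ContDiff ℝ ∞ A) (hB : ContDiff ℝ ∞ B)
    (p : E3 × ℝ) :
    heatOp (fun p => A p * B p) p = A p * heatOp B p + (heatOp A p * B p +
      2 * ∑ k, dirDeriv (spaceVec k) A p * dirDeriv (spaceVec k) B p) := by
  have h2 : ∀ k, dirDeriv (spaceVec k) (dirDeriv (spaceVec k) (fun p => A p * B p)) p =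
      A p * dirDeriv (spaceVec k) (dirDeriv (spaceVec k) B) p +
        2 * (dirDeriv (spaceVec k) A p * dirDeriv (spaceVec k) B p) +
        B p * dirDeriv (spaceVec k) (dirDeriv (spaceVec k) A) p := by
    intro k
    have hA' := contDiff_dirDeriv (spaceVec k) hA
    have hB' := contDiff_dirDeriv (spaceVec k) hB
    rw [dirDeriv_mul hA hB, dirDeriv_add (hA.mul hB') (hB.mul hA'), dirDeriv_mul hA hB',
      dirDeriv_mul hB hA']
    ring
  simp only [heatOp, h2]
  simp only [dirDeriv_mul hA hB, Fin.sum_univ_three]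
  ring

theorem dirDeriv_comp_smul {X : E3 × ℝ → ℝ} (hX : ContDiff ℝ ∞ X) (r : ℝ) (v : E3 × ℝ) :
    dirDeriv v (fun p => X (r • p)) = fun p => r * dirDeriv v X (r • p) := by
  funext p
  have h : HasFDerivAt (fun p => X (r • p)) _ p :=
    (hX.differentiable (by simp) (r • p)).hasFDerivAt.comp p
      ((hasFDerivAt_id p).const_smul r)
  simp [dirDeriv, h.fderiv]

theorem dirDeriv_const_mul {X : E3 × ℝ → ℝ} (hX : ContDiff ℝ ∞ X) (r : ℝ) (v : E3 × ℝ) :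
    dirDeriv v (fun p => r * X p) = fun p => r * dirDeriv v X p := by
  funext p
  have h := ((hX.differentiable (by simp) p).hasFDerivAt.const_mul r).fderiv
  simp [dirDeriv, h]

/-- The dilation is isotropic in space-time rather than parabolic, so the time derivative scales
like r and the Laplacian like r². Order r is enough for the limit. -/
theorem heatOp_comp_smul {X : E3 × ℝ → ℝ} (hX : ContDiff ℝ ∞ X) (r : ℝ) (p : E3 × ℝ) :
    heatOp (fun p => X (r • p)) p = r * dirDeriv (0, 1) X (r • p) +
      r * (r * ∑ k, dirDeriv (spaceVec k) (dirDeriv (spaceVec k) X) (r • p)) := by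
  have h2 : ∀ k, dirDeriv (spaceVec k) (dirDeriv (spaceVec k) (fun p => X (r • p))) p =
      r * (r * dirDeriv (spaceVec k) (dirDeriv (spaceVec k) X) (r • p)) := by
    intro k
    have hX' := contDiff_dirDeriv (spaceVec k) hX
    rw [dirDeriv_comp_smul hX, dirDeriv_const_mul (X := fun p => dirDeriv (spaceVec k) X (r • p))
      (hX'.comp (contDiff_const_smul r)), dirDeriv_comp_smul hX']
  simp only [heatOp, h2]
  simp only [dirDeriv_comp_smul hX, Finset.mul_sum]

theorem timeDeriv_smul_const {A : E3 × ℝ → ℝ} (hA : ContDiff ℝ ∞ A) (e : E3) (p : E3 × ℝ) :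
    timeDeriv (fun p => A p • e) p = dirDeriv (0, 1) A p • e := by
  have h1 : HasDerivAt (fun t : ℝ => (p.1, t)) ((0 : E3), (1 : ℝ)) p.2 :=
    (hasDerivAt_const _ _).prodMk (hasDerivAt_id _)
  have h2 : HasFDerivAt A (fderiv ℝ A p) ((fun t : ℝ => (p.1, t)) p.2) :=
    (hA.differentiable (by simp) p).hasFDerivAt
  exact ((h2.comp_hasDerivAt p.2 h1).smul_const e).deriv

theorem fderiv_slice {A : E3 × ℝ → ℝ} (hA : ContDiff ℝ ∞ A) (x : E3) (t : ℝ) (v : E3) :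
    fderiv ℝ (fun y => A (y, t)) x v = dirDeriv (v, 0) A (x, t) := by
  have h1 : HasFDerivAt (𝕜 := ℝ) (fun y : E3 => (y, t)) _ x := (hasFDerivAt_id x).prodMk
    (hasFDerivAt_const t x)
  have h2 : HasFDerivAt (fun y => A (y, t)) _ x :=
    (hA.differentiable (by simp) (x, t)).hasFDerivAt.comp x h1
  rw [h2.fderiv]
  simp [dirDeriv]

theorem spaceLaplacian_smul_const {A : E3 × ℝ → ℝ} (hA : ContDiff ℝ ∞ A) (e : E3)
    (p : E3 × ℝ) : spaceLaplacian (fun p => A p • e) p =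
      (∑ k, dirDeriv (spaceVec k) (dirDeriv (spaceVec k) A) p) • e := by
  have hs : ContDiff ℝ ∞ (fun y => A (y, p.2)) := hA.comp (by fun_prop)
  have h1 : (fun x => A (x, p.2) • e) =
      (ContinuousLinearMap.toSpanSingleton ℝ e) ∘ fun x => A (x, p.2) := by
    funext x; simp
  rw [spaceLaplacian, h1, ContDiffAt.laplacian_CLM_comp_left
    ((contDiff_infty.1 hs 2).contDiffAt), Function.comp_apply,
    ContinuousLinearMap.toSpanSingleton_apply]
  congr 1
  rw [InnerProductSpace.laplacian_eq_iteratedFDeriv_orthonormalBasis _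
    (EuclideanSpace.basisFun (Fin 3) ℝ)]
  refine Finset.sum_congr rfl fun k _ => ?_
  rw [iteratedFDeriv_two_apply]
  simp only [EuclideanSpace.basisFun_apply, Matrix.cons_val_zero, Matrix.cons_val_one]
  have hd : Differentiable ℝ (fderiv ℝ fun y => A (y, p.2)) :=
    (hs.fderiv_right (m := ∞) (by simp)).differentiable (by simp)
  have h3 : fderiv ℝ (fun y => fderiv ℝ (fun y => A (y, p.2)) y (EuclideanSpace.single k 1)) p.1
      (EuclideanSpace.single k 1) = fderiv ℝ (fderiv ℝ fun y => A (y, p.2)) p.1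
        (EuclideanSpace.single k 1) (EuclideanSpace.single k 1) := by
    rw [fderiv_clm_apply (hd _) (by fun_prop)]
    simp
  rw [← h3]
  simp only [fderiv_slice hA]
  exact fderiv_slice (contDiff_dirDeriv _ hA) p.1 p.2 _

/-! ### Reflection, parity and admissible test functions. -/

/-- Reflection in the plane `x₃ = 0`. -/
noncomputable def mirror : E3 ≃ₗᵢ[ℝ] E3 :=
  LinearIsometryEquiv.piLpCongrRight 2 fun i : Fin 3 =>
    if i = 2 then LinearIsometryEquiv.neg ℝ else LinearIsometryEquiv.refl ℝ ℝ

theorem mirror_apply (x : E3) (i : Fin 3) : mirror x i = if i = 2 then -x i else x i := by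
  simp only [mirror, LinearIsometryEquiv.piLpCongrRight_apply]
  split_ifs <;> simp

theorem mirror_mirror (x : E3) : mirror (mirror x) = x := by
  ext i; simp only [mirror_apply]; split_ifs <;> simp

theorem mirror_eq_self {x : E3} (hx : x 2 = 0) : mirror x = x := by
  ext i; rw [mirror_apply]; split_ifs with h
  · subst h; simp [hx]
  · rfl

theorem mirror_single : mirror (EuclideanSpace.single 2 1) = -EuclideanSpace.single 2 (1 : ℝ) := by
  ext i; rw [mirror_apply]; fin_cases i <;> simp

theorem gauss_mirror (z : E3) : gauss (mirror z) = gauss z := by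
  simp [gauss]

theorem measurePreserving_mirror_gaussMeasure :
    MeasurePreserving mirror gaussMeasure gaussMeasure := by
  refine ⟨mirror.continuous.measurable, Measure.ext fun s hs => ?_⟩
  rw [Measure.map_apply mirror.continuous.measurable hs, gaussMeasure, withDensity_apply _ hs,
    withDensity_apply _ (mirror.continuous.measurable hs),
    ← mirror.measurePreserving.setLIntegral_comp_preimage hs measurable_ofReal_gauss]
  simp only [gauss_mirror]

/-- The Gaussian measure is invariant under the reflection, so the potential commutes with it. -/
theorem heatPotential_mirror {Φ : E3 × ℝ → ℝ} {ε : ℝ}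
    (h : ∀ p : E3 × ℝ, Φ (mirror p.1, p.2) = ε * Φ p) (p : E3 × ℝ) :
    heatPotential Φ (mirror p.1, p.2) = ε * heatPotential Φ p := by
  have hm : MeasurePreserving (Prod.map mirror id) heatMeasure heatMeasure :=
    measurePreserving_mirror_gaussMeasure.prod (MeasurePreserving.id _)
  have hme : MeasurableEmbedding (Prod.map mirror id : E3 × ℝ → E3 × ℝ) :=
    (mirror.toHomeomorph.prodCongr (Homeomorph.refl ℝ)).measurableEmbedding
  rw [heatPotential, ← hm.integral_comp hme, heatPotential, ← integral_const_mul]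
  refine integral_congr_ae (ae_of_all _ fun q => ?_)
  dsimp only
  rw [← h]
  congr 1
  simp [heatShift]

/-- A smooth cutoff equal to `1` for `|x| ≤ 1`, `|t| ≤ 1`. -/
noncomputable def cutoff (p : E3 × ℝ) : ℝ :=
  Real.smoothTransition (2 - ‖p.1‖ ^ 2) * Real.smoothTransition (2 - p.2 ^ 2)

theorem contDiff_cutoff : ContDiff ℝ ∞ cutoff := by
  unfold cutoff
  refine ContDiff.mul ?_ ?_
  · exact Real.smoothTransition.contDiff.comp
      (contDiff_const.sub ((contDiff_norm_sq ℝ).comp contDiff_fst))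
  · exact Real.smoothTransition.contDiff.comp (by fun_prop)

theorem cutoff_eq_one {p : E3 × ℝ} (h1 : ‖p.1‖ ≤ 1) (h2 : |p.2| ≤ 1) : cutoff p = 1 := by
  rw [cutoff, Real.smoothTransition.one_of_one_le, Real.smoothTransition.one_of_one_le, one_mul]
  · have := sq_le_one_iff_abs_le_one p.2 |>.2 h2
    linarith
  · nlinarith [norm_nonneg p.1]

theorem cutoff_nonneg (p : E3 × ℝ) : 0 ≤ cutoff p :=
  mul_nonneg (Real.smoothTransition.nonneg _) (Real.smoothTransition.nonneg _)

theorem cutoff_le_one (p : E3 × ℝ) : cutoff p ≤ 1 :=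
  mul_le_one₀ (Real.smoothTransition.le_one _) (Real.smoothTransition.nonneg _)
    (Real.smoothTransition.le_one _)

theorem cutoff_mirror (p : E3 × ℝ) : cutoff (mirror p.1, p.2) = cutoff p := by
  simp [cutoff]

theorem hasCompactSupport_cutoff : HasCompactSupport cutoff := by
  refine HasCompactSupport.intro (isCompact_closedBall (0 : E3 × ℝ) 2) fun p hp => ?_
  rw [mem_closedBall_zero_iff, Prod.norm_def, max_le_iff, not_and_or] at hp
  rw [cutoff]
  rcases hp with h | h
  · rw [Real.smoothTransition.zero_of_nonpos, zero_mul]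
    nlinarith [norm_nonneg p.1]
  · rw [Real.smoothTransition.zero_of_nonpos (x := 2 - p.2 ^ 2), mul_zero]
    rw [← sq_abs, ← Real.norm_eq_abs]
    nlinarith [norm_nonneg p.2]

/-- Parity of the `i`-th component under reflection in `x₃ = 0`. -/
noncomputable def paritySign (i : Fin 3) : ℝ := if i = 2 then -1 else 1

theorem paritySign_mul_self (i : Fin 3) : paritySign i * paritySign i = 1 := by
  unfold paritySign; split_ifs <;> norm_num

/-- Parity encodes the boundary conditions: an odd function vanishes on the plane, and the normal
derivative of an even one equals its own negative there. -/
theorem isTestFunction_smul_single {A : E3 × ℝ → ℝ} (hA : ContDiff ℝ ∞ A)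
    (hs : HasCompactSupport A) (ht : tsupport A ⊆ {z | z.2 < 0}) {i : Fin 3}
    (hm : ∀ p : E3 × ℝ, A (mirror p.1, p.2) = paritySign i * A p) :
    IsTestFunction fun p => A p • EuclideanSpace.single i (1 : ℝ) where
  smooth := hA.smul contDiff_const
  compact_support := hs.smul_right
  support_subset := (tsupport_smul_subset_left _ _).trans ht
  dirichlet x t hx := by
    by_cases hi : i = 2
    · have h := hm (x, t)
      rw [mirror_eq_self hx, paritySign, if_pos hi] at h
      have : A (x, t) = 0 := by linarith
      simp [this]
    · simp [Ne.symm hi]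
  neumann j hj x t hx := by
    by_cases hij : j = i
    · subst hij
      have h1 : (fun y => (A (y, t) • EuclideanSpace.single j (1 : ℝ) : E3) j)
          = fun y => A (y, t) := by funext y; simp
      rw [h1]
      have h2 : (fun y => A (y, t)) ∘ mirror = fun y => A (y, t) := by
        funext y
        have := hm (y, t)
        rwa [paritySign, if_neg hj, one_mul] at this
      have h3 : DifferentiableAt ℝ (fun y => A (y, t)) (mirror x) :=
        ((hA.comp (by fun_prop : ContDiff ℝ ∞ fun y : E3 => (y, t))).differentiable (by simp)) _
      have h4 := fderiv_comp x h3 mirror.differentiableAt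
      rw [h2, mirror_eq_self hx] at h4
      have h5 := congrArg (fun L : E3 →L[ℝ] ℝ => L (EuclideanSpace.single 2 1)) h4
      have h6 : fderiv ℝ mirror x (EuclideanSpace.single 2 1)
          = -EuclideanSpace.single 2 (1 : ℝ) := by
        rw [mirror.fderiv]; exact mirror_single
      simp only [ContinuousLinearMap.comp_apply, h6, map_neg] at h5
      linarith
    · have h1 : (fun y => (A (y, t) • EuclideanSpace.single i (1 : ℝ) : E3) j)
          = fun _ => 0 := by funext y; simp [hij]
      rw [h1]; simp

/-- The extension of a function on the half-space by the parity of the `i`-th component. -/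
noncomputable def parityExt (i : Fin 3) (φ : E3 × ℝ → ℝ) (p : E3 × ℝ) : ℝ :=
  φ p + paritySign i * φ (mirror p.1, p.2)

theorem parityExt_mirror (i : Fin 3) (φ : E3 × ℝ → ℝ) (p : E3 × ℝ) :
    parityExt i φ (mirror p.1, p.2) = paritySign i * parityExt i φ p := by
  simp only [parityExt, mirror_mirror]
  linear_combination (-φ (mirror p.1, p.2)) * paritySign_mul_self i

/-- Reflection of space-time in `x₃ = 0`. -/
noncomputable def mirrorTime : E3 × ℝ ≃ₜ E3 × ℝ :=
  mirror.toHomeomorph.prodCongr (Homeomorph.refl ℝ)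

theorem measurePreserving_mirrorTime : MeasurePreserving mirrorTime := by
  rw [Measure.volume_eq_prod]
  exact mirror.measurePreserving.prod (MeasurePreserving.id _)

theorem contDiff_parityExt (i : Fin 3) {φ : E3 × ℝ → ℝ} (hφ : ContDiff ℝ ∞ φ) :
    ContDiff ℝ ∞ (parityExt i φ) :=
  hφ.add (contDiff_const.mul
    (hφ.comp ((mirror.contDiff.comp contDiff_fst).prodMk contDiff_snd)))

theorem hasCompactSupport_parityExt (i : Fin 3) {φ : E3 × ℝ → ℝ} (hφ : HasCompactSupport φ) :
    HasCompactSupport (parityExt i φ) :=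
  hφ.add ((hφ.comp_homeomorph mirrorTime).mul_left (f := fun _ => paritySign i))

theorem eLpNorm_parityExt_le (i : Fin 3) {φ : E3 × ℝ → ℝ} (hφ : Continuous φ) :
    eLpNorm (parityExt i φ) 2 volume ≤ 2 * eLpNorm φ 2 volume := by
  have h1 : eLpNorm (fun p => paritySign i * φ (mirrorTime p)) 2 volume = eLpNorm φ 2 volume := by
    rw [← eLpNorm_comp_measurePreserving hφ.aestronglyMeasurable measurePreserving_mirrorTime]
    refine eLpNorm_congr_norm_ae (ae_of_all _ fun p => ?_)
    have : ‖paritySign i‖ = 1 := by unfold paritySign; split_ifs <;> simp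
    rw [norm_mul, this, one_mul]; rfl
  refine (eLpNorm_add_le hφ.aestronglyMeasurable (g := fun p => paritySign i * φ (mirrorTime p))
    (continuous_const.mul (hφ.comp mirrorTime.continuous)).aestronglyMeasurable
    (by norm_num)).trans ?_
  rw [h1, two_mul]

/-! ### Truncation errors and the test of the weak identity. -/

theorem heatOp_heatPotential {Φ : E3 × ℝ → ℝ} (hΦ : ContDiff ℝ ∞ Φ) (hs : HasCompactSupport Φ)
    (p : E3 × ℝ) : heatOp (heatPotential Φ) p = -(gaussMeasure.real univ * Φ p) := by
  rw [← heatPotential_heatOp hΦ hs p]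
  have h2 : ∀ k, dirDeriv (spaceVec k) (dirDeriv (spaceVec k) (heatPotential Φ)) =
      heatPotential (dirDeriv (spaceVec k) (dirDeriv (spaceVec k) Φ)) := fun k => by
    rw [dirDeriv_heatPotential _ hΦ hs,
      dirDeriv_heatPotential _ (contDiff_dirDeriv _ hΦ) (hs.dirDeriv _)]
  rw [heatOp, dirDeriv_heatPotential _ hΦ hs, Finset.sum_congr rfl fun k _ => by rw [h2 k]]
  have i1 := integrable_comp_heatShift (contDiff_dirDeriv (0, 1) hΦ).continuous
    (hs.dirDeriv (0, 1)) p
  have i2 := fun k => integrable_comp_heatShift (contDiff_dirDeriv (spaceVec k)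
    (contDiff_dirDeriv (spaceVec k) hΦ)).continuous ((hs.dirDeriv (spaceVec k)).dirDeriv _) p
  have e : heatPotential (fun q => dirDeriv (0, 1) Φ q +
      ∑ k, dirDeriv (spaceVec k) (dirDeriv (spaceVec k) Φ) q) p =
      heatPotential (dirDeriv (0, 1) Φ) p +
      ∑ k, heatPotential (dirDeriv (spaceVec k) (dirDeriv (spaceVec k) Φ)) p := by
    simp only [heatPotential]
    rw [integral_add i1 (integrable_finsetSum _ fun k _ => i2 k),
      integral_finsetSum _ fun k _ => i2 k]
  exact e.symm

theorem exists_cutoff_bound : ∃ K : ℝ, 0 ≤ K ∧ ∀ r, 0 ≤ r → r ≤ 1 → ∀ p : E3 × ℝ,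
    |heatOp (fun p => cutoff (r • p)) p| ≤ r * K ∧
    ∀ k, |dirDeriv (spaceVec k) (fun p => cutoff (r • p)) p| ≤ r * K := by
  have hX := contDiff_cutoff
  have hs := hasCompactSupport_cutoff
  have hb : ∀ v, ∃ C, ∀ p, ‖dirDeriv v cutoff p‖ ≤ C := fun v =>
    (hs.dirDeriv v).exists_bound_of_continuous (contDiff_dirDeriv v hX).continuous
  have hb2 : ∀ v, ∃ C, ∀ p, ‖dirDeriv v (dirDeriv v cutoff) p‖ ≤ C := fun v =>
    ((hs.dirDeriv v).dirDeriv v).exists_bound_of_continuous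
      (contDiff_dirDeriv v (contDiff_dirDeriv v hX)).continuous
  choose C1 hC1 using hb
  choose C2 hC2 using hb2
  have n1 : ∀ v, 0 ≤ C1 v := fun v => (norm_nonneg _).trans (hC1 v 0)
  have n2 : ∀ v, 0 ≤ C2 v := fun v => (norm_nonneg _).trans (hC2 v 0)
  have s1 : 0 ≤ ∑ k, C1 (spaceVec k) := Finset.sum_nonneg fun k _ => n1 _
  have s2 : 0 ≤ ∑ k, C2 (spaceVec k) := Finset.sum_nonneg fun k _ => n2 _
  refine ⟨C1 (0, 1) + ∑ k, C1 (spaceVec k) + ∑ k, C2 (spaceVec k),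
    by linarith [n1 (0, 1)], fun r hr0 hr1 p => ⟨?_, fun k => ?_⟩⟩
  · rw [heatOp_comp_smul hX]
    have a1 : |dirDeriv (0, 1) cutoff (r • p)| ≤ C1 (0, 1) := hC1 _ _
    have a2 : |∑ k, dirDeriv (spaceVec k) (dirDeriv (spaceVec k) cutoff) (r • p)| ≤
        ∑ k, C2 (spaceVec k) :=
      (Finset.abs_sum_le_sum_abs _ _).trans (Finset.sum_le_sum fun k _ => hC2 _ _)
    refine (abs_add_le _ _).trans ?_
    rw [abs_mul, abs_mul, abs_mul, abs_of_nonneg hr0, ← mul_add]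
    have a3 : r * |∑ k, dirDeriv (spaceVec k) (dirDeriv (spaceVec k) cutoff) (r • p)| ≤
        1 * ∑ k, C2 (spaceVec k) := by gcongr
    exact mul_le_mul_of_nonneg_left (by linarith) hr0
  · rw [dirDeriv_comp_smul hX, abs_mul, abs_of_nonneg hr0]
    gcongr
    have a1 : |dirDeriv (spaceVec k) cutoff (r • p)| ≤ C1 (spaceVec k) := hC1 _ _
    have a2 : C1 (spaceVec k) ≤ ∑ k, C1 (spaceVec k) :=
      Finset.single_le_sum (f := fun k => C1 (spaceVec k)) (fun k _ => n1 _) (Finset.mem_univ k)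
    linarith [n1 (0, 1)]

theorem exists_heatPotential_deriv_decay {Φ : E3 × ℝ → ℝ} (hΦ : ContDiff ℝ ∞ Φ)
    (hs : HasCompactSupport Φ) (N : ℕ) (T : ℝ) : ∃ C : ℝ, 0 ≤ C ∧ ∀ p : E3 × ℝ, -T < p.2 →
      |heatPotential Φ p| * (1 + ‖p.1‖) ^ N ≤ C ∧
      ∀ k, |dirDeriv (spaceVec k) (heatPotential Φ) p| * (1 + ‖p.1‖) ^ N ≤ C := by
  obtain ⟨C0, h0⟩ := exists_heatPotential_decay hΦ.continuous hs N T
  have h1 : ∀ k : Fin 3, ∃ C, ∀ p : E3 × ℝ, -T < p.2 →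
      ‖heatPotential (dirDeriv (spaceVec k) Φ) p‖ * (1 + ‖p.1‖) ^ N ≤ C := fun k =>
    exists_heatPotential_decay (contDiff_dirDeriv _ hΦ).continuous (hs.dirDeriv _) N T
  choose C1 h1 using h1
  -- Any point in the allowed time range serves; evaluating the bounds there shows that the
  -- constants are nonnegative.
  have hq : -T < ((0 : E3), 1 - T).2 := by simp
  have n0 : 0 ≤ C0 := le_trans (by positivity) (h0 _ hq)
  have n1 : ∀ k, 0 ≤ C1 k := fun k => le_trans (by positivity) (h1 k _ hq)
  have s1 : 0 ≤ ∑ k, C1 k := Finset.sum_nonneg fun k _ => n1 _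
  refine ⟨C0 + ∑ k, C1 k, by linarith, fun p hp => ⟨?_, fun k => ?_⟩⟩
  · have := h0 p hp
    rw [Real.norm_eq_abs] at this
    linarith
  · rw [dirDeriv_heatPotential _ hΦ hs]
    have h2 := h1 k p hp
    rw [Real.norm_eq_abs] at h2
    have a2 : C1 k ≤ ∑ k, C1 k := Finset.single_le_sum (f := C1) (fun k _ => n1 k) (Finset.mem_univ k)
    linarith

theorem measurableSet_slab (R : ℝ) : MeasurableSet (halfSpace ×ˢ timeInterval R) :=
  ((isOpen_lt (f := fun _ => (0 : ℝ)) (g := fun x : E3 => x 2) (by fun_prop)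
    (by fun_prop)).prod isOpen_Ioo).measurableSet

theorem halfCylinder_subset_slab (R : ℝ) : halfCylinder R ⊆ halfSpace ×ˢ timeInterval R :=
  prod_mono (fun _ hx => hx.2) subset_rfl

theorem aestronglyMeasurable_of_weighted {μ : Measure (E3 × ℝ)} {u : E3 × ℝ → E3} {N : ℕ}
    (hu : AEStronglyMeasurable (fun z : E3 × ℝ => ((1 + ‖z.1‖) ^ N)⁻¹ • u z) μ) :
    AEStronglyMeasurable u μ := by
  have h1 : Continuous fun z : E3 × ℝ => (1 + ‖z.1‖) ^ N := by fun_prop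
  refine (h1.aestronglyMeasurable.smul hu).congr (ae_of_all _ fun z => ?_)
  have hw : (0 : ℝ) < (1 + ‖z.1‖) ^ N := by positivity
  simp [smul_smul, mul_inv_cancel₀ hw.ne']

/-- The decay of g pays for the polynomial weight in the integrability of `u`. -/
theorem weighted_integrable {S : Set (E3 × ℝ)} (hS : MeasurableSet S) {u : E3 × ℝ → E3} {N : ℕ}
    (hu : Integrable (fun z : E3 × ℝ => ((1 + ‖z.1‖) ^ N)⁻¹ • u z) (volume.restrict S))
    {g : E3 × ℝ → ℝ} (hg : Continuous g) {C : ℝ}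
    (hC : ∀ z ∈ S, |g z| * (1 + ‖z.1‖) ^ N ≤ C) (i : Fin 3) :
    Integrable (fun z => u z i * g z) (volume.restrict S) ∧
      |∫ z in S, u z i * g z| ≤ C * ∫ z in S, ‖((1 + ‖z.1‖) ^ N)⁻¹ • u z‖ := by
  have hw : ∀ z : E3 × ℝ, (0 : ℝ) < (1 + ‖z.1‖) ^ N := fun z => by positivity
  have hm := aestronglyMeasurable_of_weighted hu.aestronglyMeasurable
  have hmi : AEStronglyMeasurable (fun z => u z i) (volume.restrict S) :=
    (by fun_prop : Continuous fun x : E3 => x i).comp_aestronglyMeasurable hm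
  have hb : ∀ᵐ z ∂(volume.restrict S), ‖u z i * g z‖ ≤
      C * ‖((1 + ‖z.1‖) ^ N)⁻¹ • u z‖ := by
    filter_upwards [ae_restrict_mem hS] with z hz
    rw [norm_mul, norm_smul, norm_inv, Real.norm_of_nonneg (hw z).le]
    have h2 : ‖u z i‖ ≤ ‖u z‖ := PiLp.norm_apply_le (u z) i
    have h3 := hC z hz
    rw [← le_div_iff₀ (hw z)] at h3
    calc ‖u z i‖ * ‖g z‖ ≤ ‖u z‖ * (C / (1 + ‖z.1‖) ^ N) := by
          gcongr; exact h3
      _ = _ := by rw [div_eq_mul_inv]; ring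
  refine ⟨(hu.norm.const_mul C).mono' (hmi.mul hg.aestronglyMeasurable) hb, ?_⟩
  rw [← integral_const_mul, ← Real.norm_eq_abs]
  exact norm_integral_le_of_norm_le (hu.norm.const_mul C) hb

theorem parityExt_eq_of_pos (i : Fin 3) {φ : E3 × ℝ → ℝ} (hφ : ∀ z, φ z ≠ 0 → 0 < z.1 2)
    {z : E3 × ℝ} (hz : 0 < z.1 2) : parityExt i φ z = φ z := by
  have h0 : φ (mirror z.1, z.2) = 0 := by
    by_contra h
    have h1 := hφ _ h
    rw [mirror_apply, if_pos rfl] at h1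
    linarith
  rw [parityExt, h0]; simp

/-- Compactness gives a uniform gap before t = 0. The potential inherits this gap, as test functions
must vanish near the final time. -/
theorem exists_support_time_lt {φ : E3 × ℝ → ℝ} (hs : HasCompactSupport φ)
    (ht : ∀ z ∈ tsupport φ, z.2 < 0) : ∃ δ < 0, ∀ z, φ z ≠ 0 → z.2 ≤ δ := by
  obtain ⟨a, ha, hb⟩ := hs.isCompact.exists_forall_le' (f := fun z : E3 × ℝ => -z.2)
    (a := 0) (by fun_prop) (fun z hz => by have := ht z hz; linarith)
  exact ⟨-a, by linarith, fun z hz => by have := hb z (subset_tsupport _ hz); linarith⟩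

/-- Testing with A(r·) H e_i gives c₀ ∫ u_i φ - ∫ u_i E = ∫ f_i A H, where E collects the terms with
derivatives of the cutoff. The right side is at most ∫ |f| |H| because 0 ≤ A ≤ 1, and the E-term is
O(r). -/
theorem integral_component_mul_le {R : ℝ} {f u : E3 × ℝ → E3}
    (hu : SolvesHalfSpaceHeat R ((halfCylinder R).indicator f) u) {φ : E3 × ℝ → ℝ}
    (hφ : ContDiff ℝ ∞ φ) (hs : HasCompactSupport φ) (hsub : tsupport φ ⊆ halfCylinder R)
    (i : Fin 3) {B : ℝ} (hB0 : 0 ≤ B)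
    (hB : ∫⁻ z in halfCylinder R, ‖f z‖ₑ * ‖heatPotential (parityExt i φ) z‖ₑ
      ≤ ENNReal.ofReal B) :
    gaussMeasure.real univ * |∫ z in halfSpace ×ˢ timeInterval R, u z i * φ z| ≤ B := by
  set S := halfSpace ×ˢ timeInterval R with hSdef
  have hS : MeasurableSet S := measurableSet_slab R
  set Φ := parityExt i φ with hΦdef
  have hΦ : ContDiff ℝ ∞ Φ := contDiff_parityExt i hφ
  have hΦs : HasCompactSupport Φ := hasCompactSupport_parityExt i hs
  set H := heatPotential Φ with hHdef
  have hH : ContDiff ℝ ∞ H := contDiff_heatPotential hΦ hΦs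
  obtain ⟨N, hN⟩ := hu.growth
  set M := ∫ z in S, ‖((1 + ‖z.1‖) ^ N)⁻¹ • u z‖ with hM
  have hM0 : 0 ≤ M := integral_nonneg fun z => norm_nonneg _
  obtain ⟨K, hK0, hK⟩ := exists_cutoff_bound
  obtain ⟨C, hC0, hC⟩ := exists_heatPotential_deriv_decay hΦ hΦs N (R ^ 2)
  obtain ⟨P, hP0, hP⟩ := hΦs.exists_time_bound
  obtain ⟨δ, hδ, hφδ⟩ := exists_support_time_lt hs fun z hz => (hsub hz).2.2
  have hHδ : ∀ p : E3 × ℝ, δ < p.2 → H p = 0 := fun p hp => heatPotential_eq_zero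
    (fun q hq => by
      have h1 : φ q = 0 := by by_contra h; linarith [hφδ q h]
      have h2 : φ (mirror q.1, q.2) = 0 := by
        by_contra h
        have := hφδ _ h
        simp only at this; linarith
      simp [hΦdef, parityExt, h1, h2]) hp
  have hSpos : ∀ z ∈ S, 0 < z.1 2 := fun z hz => hz.1
  have hSt : ∀ z ∈ S, -R ^ 2 < z.2 := fun z hz => hz.2.1
  have hΦφ : ∀ z ∈ S, Φ z = φ z := fun z hz =>
    parityExt_eq_of_pos i (fun y hy => (hsub (subset_tsupport _ hy)).1.2) (hSpos z hz)
  set c0 := gaussMeasure.real univ with hc0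
  -- The condition rP ≤ 1 makes the cutoff equal to 1 on the support of Φ. The constant 7 is 1 +
  -- 2·3: one term with the heat operator on A, and twice three products of first derivatives.
  have key : ∀ r : ℝ, 0 < r → r ≤ 1 → r * P ≤ 1 →
      c0 * |∫ z in S, u z i * φ z| ≤ r * (7 * K * C * M) + B := by
    intro r hr0 hr1 hrP
    set A : E3 × ℝ → ℝ := fun p => cutoff (r • p) with hA
    have hAc : ContDiff ℝ ∞ A := contDiff_cutoff.comp (contDiff_const_smul r)
    have hAs : HasCompactSupport A := hasCompactSupport_cutoff.comp_smul hr0.ne'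
    have hη : IsTestFunction fun p => (A p * H p) • EuclideanSpace.single i (1 : ℝ) := by
      refine isTestFunction_smul_single (hAc.mul hH) hAs.mul_right ?_ fun p => ?_
      · have hcl : IsClosed {z : E3 × ℝ | z.2 ≤ δ} := isClosed_le (by fun_prop) (by fun_prop)
        refine (closure_minimal (fun z hz => ?_) hcl).trans fun z (hz : z.2 ≤ δ) =>
          lt_of_le_of_lt hz hδ
        by_contra h
        exact hz (by simp [hHδ z (not_le.1 h)])
      · have h1 : A (mirror p.1, p.2) = A p := by
          have := cutoff_mirror (r • p)
          simpa [hA] using this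
        have h2 : H (mirror p.1, p.2) = paritySign i * H p :=
          heatPotential_mirror (parityExt_mirror i φ) p
        rw [h1, h2]; ring
    set E : E3 × ℝ → ℝ := fun p => heatOp A p * H p +
      2 * ∑ k, dirDeriv (spaceVec k) A p * dirDeriv (spaceVec k) H p with hE
    have hheatA : Continuous (heatOp A) :=
      (contDiff_dirDeriv _ hAc).continuous.add (continuous_finsetSum _ fun k _ =>
        (contDiff_dirDeriv _ (contDiff_dirDeriv _ hAc)).continuous)
    have hEc : Continuous E := (hheatA.mul hH.continuous).add (continuous_const.mul
      (continuous_finsetSum _ fun k _ =>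
        (contDiff_dirDeriv _ hAc).continuous.mul (contDiff_dirDeriv _ hH).continuous))
    have hEb : ∀ z ∈ S, |E z| * (1 + ‖z.1‖) ^ N ≤ r * (7 * K * C) := by
      intro z hz
      obtain ⟨k1, k2⟩ := hK r hr0.le hr1 z
      obtain ⟨d1, d2⟩ := hC z (hSt z hz)
      have hw : 0 ≤ (1 + ‖z.1‖) ^ N := by positivity
      have hrK : 0 ≤ r * K := mul_nonneg hr0.le hK0
      have e1 : |heatOp A z * H z| * (1 + ‖z.1‖) ^ N ≤ r * K * C := by
        rw [abs_mul, mul_assoc]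
        exact mul_le_mul k1 d1 (by positivity) hrK
      have e2 : ∀ k, |dirDeriv (spaceVec k) A z * dirDeriv (spaceVec k) H z| *
          (1 + ‖z.1‖) ^ N ≤ r * K * C := fun k => by
        rw [abs_mul, mul_assoc]
        exact mul_le_mul (k2 k) (d2 k) (by positivity) hrK
      have e3 : |∑ k, dirDeriv (spaceVec k) A z * dirDeriv (spaceVec k) H z| *
          (1 + ‖z.1‖) ^ N ≤ 3 * (r * K * C) := by
        calc _ ≤ (∑ k, |dirDeriv (spaceVec k) A z * dirDeriv (spaceVec k) H z|) *
              (1 + ‖z.1‖) ^ N := by gcongr; exact Finset.abs_sum_le_sum_abs _ _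
          _ ≤ ∑ _k : Fin 3, r * K * C := by
              rw [Finset.sum_mul]; exact Finset.sum_le_sum fun k _ => e2 k
          _ = _ := by simp
      calc |E z| * (1 + ‖z.1‖) ^ N ≤ (|heatOp A z * H z| +
            |2 * ∑ k, dirDeriv (spaceVec k) A z * dirDeriv (spaceVec k) H z|) *
              (1 + ‖z.1‖) ^ N := by gcongr; exact abs_add_le _ _
        _ = |heatOp A z * H z| * (1 + ‖z.1‖) ^ N +
            2 * (|∑ k, dirDeriv (spaceVec k) A z * dirDeriv (spaceVec k) H z| *
              (1 + ‖z.1‖) ^ N) := by rw [abs_mul (2 : ℝ), abs_two]; ring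
        _ ≤ r * (7 * K * C) := by linarith
    obtain ⟨iE, bE⟩ := weighted_integrable hS hN hEc hEb i
    have hφb : ∃ D, ∀ z ∈ S, |φ z| * (1 + ‖z.1‖) ^ N ≤ D := by
      obtain ⟨D, hD⟩ := (hs.mul_right (f' := fun z : E3 × ℝ => (1 + ‖z.1‖) ^ N)
        ).exists_bound_of_continuous (hφ.continuous.mul (by fun_prop))
      refine ⟨D, fun z _ => ?_⟩
      have := hD z
      rwa [Pi.mul_apply, norm_mul, Real.norm_eq_abs, Real.norm_of_nonneg (by positivity)] at this
    obtain ⟨D, hD⟩ := hφb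
    obtain ⟨iφ, -⟩ := weighted_integrable hS hN hφ.continuous hD i
    have hid := hu.identity _ hη
    have hL : ∫ z in S, inner ℝ (u z) (-timeDeriv (fun p => (A p * H p) •
        EuclideanSpace.single i (1 : ℝ)) z - spaceLaplacian (fun p => (A p * H p) •
        EuclideanSpace.single i (1 : ℝ)) z) = c0 * (∫ z in S, u z i * φ z) -
        ∫ z in S, u z i * E z := by
      rw [← integral_const_mul, ← integral_sub (iφ.const_mul _) iE]
      refine setIntegral_congr_fun hS fun z hz => ?_
      dsimp only
      have hAΦ : A z * Φ z = φ z := by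
        rw [← hΦφ z hz]
        by_cases h : Φ z = 0
        · simp [h]
        · obtain ⟨p1, p2⟩ := hP z h
          have : A z = 1 := by
            refine cutoff_eq_one ?_ ?_
            · rw [Prod.smul_fst, norm_smul, Real.norm_of_nonneg hr0.le]
              exact (mul_le_mul_of_nonneg_left p1 hr0.le).trans hrP
            · rw [Prod.smul_snd, smul_eq_mul, abs_mul, abs_of_pos hr0]
              exact (mul_le_mul_of_nonneg_left p2 hr0.le).trans hrP
          rw [this, one_mul]
      have hop : heatOp (fun p => A p * H p) z = -(c0 * φ z) + E z := by
        rw [heatOp_mul hAc hH, hHdef, heatOp_heatPotential hΦ hΦs, ← hAΦ]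
        ring
      rw [timeDeriv_smul_const (hAc.mul hH), spaceLaplacian_smul_const (hAc.mul hH),
        ← neg_smul, ← sub_smul, inner_smul_right, EuclideanSpace.inner_single_right]
      have : -dirDeriv (0, 1) (fun p => A p * H p) z - ∑ k, dirDeriv (spaceVec k)
          (dirDeriv (spaceVec k) fun p => A p * H p) z = -heatOp (fun p => A p * H p) z := by
        rw [heatOp]; ring
      rw [this, hop]
      simp
      ring
    have hR : |∫ z in S, inner ℝ ((halfCylinder R).indicator f z)
        ((A z * H z) • EuclideanSpace.single i (1 : ℝ))| ≤ B := by
      rw [← Real.norm_eq_abs, ← ENNReal.ofReal_le_ofReal_iff hB0, ofReal_norm]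
      refine (enorm_integral_le_lintegral_enorm _).trans (le_trans ?_ hB)
      rw [← lintegral_indicator (isOpen_halfCylinder R).measurableSet]
      refine le_trans (lintegral_mono fun z => ?_) (setLIntegral_le_lintegral S _)
      by_cases hz : z ∈ halfCylinder R
      · rw [indicator_of_mem hz, indicator_of_mem hz, ← ofReal_norm, ← ofReal_norm, ← ofReal_norm,
          ← ENNReal.ofReal_mul (norm_nonneg _)]
        refine ENNReal.ofReal_le_ofReal ((norm_inner_le_norm _ _).trans ?_)
        rw [norm_smul, norm_mul]
        have hA1 : ‖A z‖ ≤ 1 := by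
          rw [Real.norm_of_nonneg (cutoff_nonneg _)]; exact cutoff_le_one _
        have : ‖EuclideanSpace.single i (1 : ℝ)‖ = 1 := by simp
        rw [this, mul_one]
        gcongr
        exact mul_le_of_le_one_left (norm_nonneg _) hA1
      · simp [indicator_of_notMem hz]
    rw [hL] at hid
    rw [← hid] at hR
    have hc : 0 < c0 := gaussMeasure_real_univ_pos
    have h1 : c0 * |∫ z in S, u z i * φ z| = |c0 * ∫ z in S, u z i * φ z| := by
      rw [abs_mul, abs_of_pos hc]
    rw [h1]
    calc |c0 * ∫ z in S, u z i * φ z| = |(∫ z in S, u z i * E z) +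
          (c0 * (∫ z in S, u z i * φ z) - ∫ z in S, u z i * E z)| := by ring_nf
      _ ≤ _ := abs_add_le _ _
      _ ≤ r * (7 * K * C) * M + B := add_le_add bE hR
      _ = _ := by ring
  -- The limit r → 0 in explicit form: the first entry of the minimum gives r ≤ 1 and rP ≤ 1, the
  -- second makes the error at most half of the supposed excess X - B.
  by_contra! hcon
  set X := c0 * |∫ z in S, u z i * φ z| with hX
  set L := 7 * K * C * M with hLdef
  have hL0 : 0 ≤ L := by positivity
  have hgap : 0 < X - B := by linarith
  set r := min (1 / (1 + P)) ((X - B) / (2 * (1 + L))) with hr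
  have hr0 : 0 < r := by positivity
  have hr1 : r ≤ 1 / (1 + P) := min_le_left _ _
  have hr2 : r ≤ (X - B) / (2 * (1 + L)) := min_le_right _ _
  rw [le_div_iff₀ (by positivity)] at hr1 hr2
  have := key r hr0 (by nlinarith) (by nlinarith)
  nlinarith

/-! ### An L₂ bound from testing against smooth functions. -/

/-- As v is only integrable, it cannot be used as its own test function. Pairing with v is a bounded
functional on the classes of test functions in L₂; Hahn–Banach extends it with the same norm and
Riesz represents it by some w of norm at most A. Then v - w annihilates all test functions in Q, so
v = w almost everywhere. -/
theorem eLpNorm_two_le_of_duality {G : Type*} [NormedAddCommGroup G] [NormedSpace ℝ G]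
    [FiniteDimensional ℝ G] [MeasurableSpace G] [BorelSpace G] {μ : Measure G}
    [IsFiniteMeasure μ] {Q : Set G} (hQ : IsOpen Q) (hμ : ∀ᵐ z ∂μ, z ∈ Q) {v : G → ℝ}
    (hv : Integrable v μ) {A : ℝ} (hA : 0 ≤ A)
    (h : ∀ φ : G → ℝ, ContDiff ℝ ∞ φ → HasCompactSupport φ → tsupport φ ⊆ Q →
      |∫ z, v z * φ z ∂μ| ≤ A * (eLpNorm φ 2 μ).toReal) :
    eLpNorm v 2 μ ≤ ENNReal.ofReal A := by
  have hint : ∀ φ : G → ℝ, ContDiff ℝ ∞ φ → HasCompactSupport φ →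
      Integrable (fun z => v z * φ z) μ := fun φ h1 h2 => by
    obtain ⟨C, hC⟩ := h2.exists_bound_of_continuous h1.continuous
    exact hv.mul_bdd h1.continuous.aestronglyMeasurable (ae_of_all _ hC)
  let S : Submodule ℝ (Lp ℝ 2 μ) :=
    { carrier := {w | ∃ φ : G → ℝ, ContDiff ℝ ∞ φ ∧ HasCompactSupport φ ∧ tsupport φ ⊆ Q ∧
        w =ᵐ[μ] φ}
      add_mem' := by
        rintro a b ⟨φ, p1, p2, p3, p4⟩ ⟨ψ, q1, q2, q3, q4⟩
        exact ⟨φ + ψ, p1.add q1, p2.add q2, (tsupport_add _ _).trans (union_subset p3 q3),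
          (Lp.coeFn_add a b).trans (p4.add q4)⟩
      zero_mem' := ⟨0, contDiff_const, HasCompactSupport.zero, by simp [tsupport],
        Lp.coeFn_zero ℝ 2 μ⟩
      smul_mem' := by
        rintro c a ⟨φ, p1, p2, p3, p4⟩
        refine ⟨fun z => c • φ z, p1.const_smul c, p2.smul_left (f := fun _ => c),
          (tsupport_smul_subset_right (fun _ => c) φ).trans p3, ?_⟩
        filter_upwards [Lp.coeFn_smul c a, p4] with z h1 h2
        rw [h1, Pi.smul_apply, h2] }
  have hSint : ∀ w : S, Integrable (fun z => v z * (w : Lp ℝ 2 μ) z) μ := by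
    rintro ⟨w, φ, p1, p2, p3, p4⟩
    refine (hint φ p1 p2).congr ?_
    filter_upwards [p4] with z hz
    rw [hz]
  let L : S →ₗ[ℝ] ℝ :=
    { toFun := fun w => ∫ z, v z * (w : Lp ℝ 2 μ) z ∂μ
      map_add' := fun a b => by
        rw [← integral_add (hSint a) (hSint b)]
        refine integral_congr_ae ?_
        filter_upwards [Lp.coeFn_add (a : Lp ℝ 2 μ) (b : Lp ℝ 2 μ)] with z hz
        rw [Submodule.coe_add, hz, Pi.add_apply, mul_add]
      map_smul' := fun c a => by
        rw [RingHom.id_apply, smul_eq_mul, ← integral_const_mul]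
        refine integral_congr_ae ?_
        filter_upwards [Lp.coeFn_smul c (a : Lp ℝ 2 μ)] with z hz
        rw [Submodule.coe_smul, hz, Pi.smul_apply, smul_eq_mul]
        ring }
  have hL : ∀ w : S, ‖L w‖ ≤ A * ‖w‖ := by
    rintro ⟨w, φ, p1, p2, p3, p4⟩
    have e1 : L ⟨w, φ, p1, p2, p3, p4⟩ = ∫ z, v z * φ z ∂μ :=
      integral_congr_ae (by filter_upwards [p4] with z hz using by simp only [hz])
    rw [e1, Real.norm_eq_abs, Submodule.coe_norm, Lp.norm_def, eLpNorm_congr_ae p4]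
    exact h φ p1 p2 p3
  obtain ⟨g, hg1, hg2⟩ := exists_extension_norm_eq S (L.mkContinuous A hL)
  set w : Lp ℝ 2 μ := (InnerProductSpace.toDual ℝ (Lp ℝ 2 μ)).symm g with hw
  have hwn : ‖w‖ ≤ A := by
    rw [hw, LinearIsometryEquiv.norm_map, hg2]
    exact L.mkContinuous_norm_le hA hL
  have hwi : Integrable w μ := (Lp.memLp w).integrable (by norm_num)
  have hzero := hQ.ae_eq_zero_of_integral_contDiff_smul_eq_zero (μ := μ)
    (f := fun z => v z - w z) ((hv.sub hwi).locallyIntegrable.locallyIntegrableOn Q)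
    (fun φ p1 p2 p3 => by
      have hφL : MemLp φ 2 μ := p1.continuous.memLp_of_hasCompactSupport p2
      have hmem : hφL.toLp φ ∈ S := ⟨φ, p1, p2, p3, hφL.coeFn_toLp⟩
      have e1 : g (hφL.toLp φ) = ∫ z, v z * φ z ∂μ := by
        have := hg1 ⟨_, hmem⟩
        rw [this]
        exact integral_congr_ae (by
          filter_upwards [hφL.coeFn_toLp] with z hz using by simp only [hz])
      have e2 : g (hφL.toLp φ) = ∫ z, w z * φ z ∂μ := by
        rw [← InnerProductSpace.toDual_symm_apply, L2.inner_def]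
        refine integral_congr_ae ?_
        filter_upwards [hφL.coeFn_toLp] with z hz
        rw [hz]
        simp [hw, mul_comm]
      have iw : Integrable (fun z => w z * φ z) μ := by
        obtain ⟨C, hC⟩ := p2.exists_bound_of_continuous p1.continuous
        exact hwi.mul_bdd p1.continuous.aestronglyMeasurable (ae_of_all _ hC)
      have e3 : ∫ z, φ z • (v z - w z) ∂μ = (∫ z, v z * φ z ∂μ) - ∫ z, w z * φ z ∂μ := by
        rw [← integral_sub (hint φ p1 p2) iw]
        refine integral_congr_ae (ae_of_all _ fun z => ?_)
        simp only [smul_eq_mul]; ring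
      rw [e3, ← e1, ← e2, sub_self])
  have hvw : v =ᵐ[μ] w := by
    filter_upwards [hzero, hμ] with z h1 h2
    exact sub_eq_zero.1 (h1 h2)
  rw [eLpNorm_congr_ae hvw, ← ENNReal.ofReal_toReal (Lp.eLpNorm_ne_top w), ← Lp.norm_def]
  exact ENNReal.ofReal_le_ofReal hwn

/-! ### Norm identities and assembly of the estimate. -/

theorem eLpNorm_two_eq_lintegral {α F : Type*} [MeasurableSpace α] [NormedAddCommGroup F]
    (g : α → F) (μ : Measure α) :
    eLpNorm g 2 μ = (∫⁻ z, ‖g z‖ₑ ^ (2 : ℝ) ∂μ) ^ (1 / 2 : ℝ) := by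
  rw [eLpNorm_eq_lintegral_rpow_enorm_toReal (by norm_num) (by norm_num)]
  simp

theorem mixedNorm_two_two {R : ℝ} {h : E3 × ℝ → E3}
    (hh : AEStronglyMeasurable h (volume.restrict (halfCylinder R))) :
    mixedNorm 2 2 (halfBall R) (timeInterval R) h =
      eLpNorm h 2 (volume.restrict (halfCylinder R)) := by
  rw [restrict_halfCylinder] at hh ⊢
  rw [eLpNorm_two_eq_lintegral, lintegral_prod_symm _ (hh.enorm.pow_const _), mixedNorm]
  norm_num

theorem eLpNorm_le_sum_components {μ : Measure (E3 × ℝ)} {u : E3 × ℝ → E3}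
    (hu : AEStronglyMeasurable u μ) : eLpNorm u 2 μ ≤ ∑ i, eLpNorm (fun z => u z i) 2 μ := by
  have hi : ∀ i : Fin 3, AEStronglyMeasurable (fun z => u z i) μ := fun i =>
    (by fun_prop : Continuous fun x : E3 => x i).comp_aestronglyMeasurable hu
  have h2 : ∀ z, ‖u z‖ ≤ ∑ i, ‖u z i‖ := fun z => by
    have h3 : u z = ∑ i, u z i • (EuclideanSpace.basisFun (Fin 3) ℝ) i := by
      have := (EuclideanSpace.basisFun (Fin 3) ℝ).sum_repr (u z)
      simpa using this.symm
    calc ‖u z‖ = ‖∑ i, u z i • (EuclideanSpace.basisFun (Fin 3) ℝ) i‖ := congrArg norm h3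
      _ ≤ ∑ i, ‖u z i • (EuclideanSpace.basisFun (Fin 3) ℝ) i‖ := norm_sum_le _ _
      _ = _ := Finset.sum_congr rfl fun i _ => by
        rw [norm_smul, OrthonormalBasis.norm_eq_one, mul_one]
  have h4 : ∀ i : Fin 3, eLpNorm (fun z => ‖u z i‖) 2 μ = eLpNorm (fun z => u z i) 2 μ :=
    fun i => eLpNorm_norm fun z => u z i
  calc eLpNorm u 2 μ ≤ eLpNorm (∑ i : Fin 3, fun z => ‖u z i‖) 2 μ :=
        eLpNorm_mono_real fun z => (h2 z).trans_eq (by rw [Finset.sum_apply])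
    _ ≤ ∑ i : Fin 3, eLpNorm (fun z => ‖u z i‖) 2 μ :=
        eLpNorm_sum_le (fun i _ => (hi i).norm) (by norm_num)
    _ = _ := Finset.sum_congr rfl fun i _ => h4 i

theorem volume_halfCylinder_lt_top (R : ℝ) :
    (volume : Measure (E3 × ℝ)) (halfCylinder R) < ⊤ := by
  rw [Measure.volume_eq_prod, halfCylinder, Measure.prod_prod]
  refine ENNReal.mul_lt_top (lt_of_le_of_lt (measure_mono (t := Metric.ball 0 R) fun x hx => ?_)
    measure_ball_lt_top) (by simp [timeInterval])
  simpa using hx.1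

/-- In the constant, the 2 is the cost in L₂ of adding the reflected copy of φ, and the division by
the Gaussian mass compensates for the unnormalized kernel. -/
theorem eLpNorm_component_le {R : ℝ} (hR : 0 < R) {f u : E3 × ℝ → E3}
    (hf : MemMixed (3 / 2) 1 R f)
    (hu : SolvesHalfSpaceHeat R ((halfCylinder R).indicator f) u) (i : Fin 3) :
    eLpNorm (fun z => u z i) 2 (volume.restrict (halfCylinder R)) ≤
      ENNReal.ofReal (2 * heatConst.toReal / gaussMeasure.real univ * R ^ (1 / 2 : ℝ) *
        (mixedNorm (3 / 2) 1 (halfBall R) (timeInterval R) f).toReal) := by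
  have hQ := isOpen_halfCylinder R
  have hfin : IsFiniteMeasure (volume.restrict (halfCylinder R) : Measure (E3 × ℝ)) :=
    isFiniteMeasure_restrict.2 (volume_halfCylinder_lt_top R).ne
  obtain ⟨N, hN⟩ := hu.growth
  have hNQ := hN.mono_measure (Measure.restrict_mono (halfCylinder_subset_slab R) le_rfl)
  have hui : Integrable (fun z => u z i) (volume.restrict (halfCylinder R)) := by
    have := (weighted_integrable hQ.measurableSet hNQ (g := fun _ => 1) continuous_const
      (C := (1 + R) ^ N) (fun z hz => by
        rw [abs_one, one_mul]
        gcongr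
        exact hz.1.1.le) i).1
    simpa using this
  have hc0 := gaussMeasure_real_univ_pos
  set F := mixedNorm (3 / 2) 1 (halfBall R) (timeInterval R) f with hF
  refine eLpNorm_two_le_of_duality hQ (ae_restrict_mem hQ.measurableSet) hui (by positivity)
    fun φ h1 h2 h3 => ?_
  have hφ : eLpNorm φ 2 (volume.restrict (halfCylinder R)) = eLpNorm φ 2 volume :=
    eLpNorm_restrict_eq_of_support_subset ((subset_tsupport φ).trans h3)
  have hφt : eLpNorm φ 2 volume ≠ ⊤ :=
    (h1.continuous.memLp_of_hasCompactSupport h2).eLpNorm_ne_top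
  have hneg : ∀ p, parityExt i φ p ≠ 0 → p.2 < 0 := by
    intro p hp
    by_contra hcon
    have z1 : ∀ y : E3, φ (y, p.2) = 0 := fun y => by
      by_contra h
      exact hcon (h3 (subset_tsupport _ h)).2.2
    exact hp (by simp [parityExt, z1])
  have hB : ∫⁻ z in halfCylinder R, ‖f z‖ₑ * ‖heatPotential (parityExt i φ) z‖ₑ ≤
      ENNReal.ofReal (heatConst.toReal * R ^ (1 / 2 : ℝ) * F.toReal *
        (2 * (eLpNorm φ 2 volume).toReal)) := by
    refine (lintegral_mul_heatPotential_le hR hf.1 (contDiff_parityExt i h1)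
      (hasCompactSupport_parityExt i h2) hneg).trans ?_
    rw [← eLpNorm_two_eq_lintegral, ENNReal.ofReal_mul (by positivity),
      ENNReal.ofReal_mul (by positivity), ENNReal.ofReal_mul (by positivity),
      ENNReal.ofReal_mul (by norm_num), ENNReal.ofReal_toReal heatConst_lt_top.ne,
      ENNReal.ofReal_toReal hf.2.ne, ENNReal.ofReal_toReal hφt,
      ENNReal.ofReal_rpow_of_nonneg hR.le (by norm_num)]
    gcongr
    simpa using eLpNorm_parityExt_le i h1.continuous
  have key := integral_component_mul_le hu h1 h2 h3 i (by positivity) hB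
  have hS : ∫ z in halfSpace ×ˢ timeInterval R, u z i * φ z =
      ∫ z in halfCylinder R, u z i * φ z :=
    setIntegral_eq_of_subset_of_forall_sdiff_eq_zero (measurableSet_slab R)
      (halfCylinder_subset_slab R) fun z hz => by
        have : φ z = 0 := by
          by_contra h
          exact hz.2 (h3 (subset_tsupport _ h))
        rw [this, mul_zero]
  rw [hS, mul_comm, ← le_div_iff₀ hc0] at key
  rw [hφ]
  refine key.trans (le_of_eq ?_)
  ring

theorem mainTheorem6 :
    ∃ c : ℝ, 0 < c ∧ ∀ (R : ℝ) (f h : E3 × ℝ → E3), 0 < R →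
      MemMixed (3 / 2) 1 R f →
      IsHalfCylinderHeatSolution R f h →
      mixedNorm 2 2 (halfBall R) (timeInterval R) h ≤
        ENNReal.ofReal (c * R ^ (1 / 2 : ℝ)) *
          mixedNorm (3 / 2) 1 (halfBall R) (timeInterval R) f := by
  have hc0 := gaussMeasure_real_univ_pos
  -- The 3 counts the components; the added 1 makes positivity immediate without showing `heatConst`
  -- to be nonzero.
  refine ⟨3 * (2 * heatConst.toReal / gaussMeasure.real univ) + 1, by positivity, ?_⟩
  rintro R f h hR hf ⟨u, hu, hhu⟩
  obtain ⟨N, hN⟩ := hu.growth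
  have hum : AEStronglyMeasurable u (volume.restrict (halfCylinder R)) :=
    aestronglyMeasurable_of_weighted (hN.mono_measure
      (Measure.restrict_mono (halfCylinder_subset_slab R) le_rfl)).aestronglyMeasurable
  rw [mixedNorm_two_two (hum.congr hhu.symm), eLpNorm_congr_ae hhu]
  refine (eLpNorm_le_sum_components hum).trans
    ((Finset.sum_le_sum fun i _ => eLpNorm_component_le hR hf hu i).trans ?_)
  set F := mixedNorm (3 / 2) 1 (halfBall R) (timeInterval R) f with hF
  have hFt : F = ENNReal.ofReal F.toReal := (ENNReal.ofReal_toReal hf.2.ne).symm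
  have hF0 : 0 ≤ F.toReal := ENNReal.toReal_nonneg
  generalize F.toReal = y at hFt hF0 ⊢
  rw [hFt, ← ENNReal.ofReal_mul (by positivity), Finset.sum_const, Finset.card_univ, Fintype.card_fin,
    nsmul_eq_mul, Nat.cast_ofNat, ← ENNReal.ofReal_ofNat, ← ENNReal.ofReal_mul (by norm_num)]
  refine ENNReal.ofReal_le_ofReal ?_
  have : 0 ≤ R ^ (1 / 2 : ℝ) * y := by positivity
  nlinarith
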